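/- \textbf{The problem.} Let $N\ge 0$, $T\ge 0$ be integers, $m>0$, $\Delta t>0$, $\mathbf g,\mathbf c_{init},\dot{\mathbf c}_{init},\mathbf k_{init}\in\mathbb R^3$ and $\mathbf r_i^j\in\mathbb R^3$ ($0\le i<T$, $1\le j\le N$). Write $x=(x_0,\dots,x_T)$ with blocks $x_i=(\mathbf f_i^1,\dots,\mathbf f_i^N)\in(\mathbb R^3)^N$, and $z=(\mathbf k'_0,\dots,\mathbf k'_T)$, so that $n_x=3N(T+1)$ and $n_z=n_c=3(T+1)$. All norms are Euclidean. The locomotion problem is $$\min_{x,z}\ f(x)+\phi(z)+\sum_{i=0}^T I_i(x_i)\quad\text{s.t.}\quad \mathbf k'_0=\mathbf k_{init},\quad \mathbf k'_{i+1}=\sum_{j=1}^N\big((\mathbf r_i^j-\mathbf c_i(x))\times\mathbf f_i^j\big)\Delta t\ \ (0\le i\le T-1),$$ $$\mathbf c_i(x)=\mathbf c_{init}+\dot{\mathbf c}_{init}\,i\,\Delta t+\sum_{i'=0}^{i-2}(i-1-i')\Big(\sum_{l=1}^N\frac{\mathbf f_{i'}^l}{m}+\mathbf g\Big)(\Delta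 t)^2,$$ where $I_i$ is the indicator function ($0$ on $X_i$, $+\infty$ elsewhere) of a set $X_i\subseteq(\mathbb R^3)^N$. Write the equality constraints as $A(x)+z=0$, where $A(x)$ is the negative of the vector of right-hand sides, and let $$L(x,z,w)=f(x)+\phi(z)+\sum_{i=0}^T I_i(x_i)+\langle w,A(x)+z\rangle+\frac{\rho}{2}\|A(x)+z\|^2 .$$ The ADMM with initial point $(x^0,z^0,w^0)$ generates iterates with, for $k\ge 0$: successively for $i=0,\dots,T$, $x_i^{k+1}\in\arg\min_{y} L\big((x_0^{k+1},\dots,x_{i-1}^{k+1},y,x_{i+1}^k,\dots,x_T^k),z^k,w^k\big)$; then $z^{k+1}\in\arg\min_z L(x^{k+1},z,w^k)$; then $w^{k+1}=w^k+\rho\,(A(x^{k+1})+z^{k+1})$. \textbf{Statement.} Fix $N$, $m>0$, $\mathbf g,\mathbf c_{init},\dot{\mathbf c}_{init},\mathbf k_{init}$, a time horizon $T_{total}>0$ and constants $R$, $M$, $\mu_f,L_f,\mu_\phi,L_\phi$ with $\mu_f,L_f,\mu_\phi,L_\phi>0$. There is $t_0>0$, depending only on these, such that the following holds for every $T$ and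 $\Delta t$ with $0<\Delta t\le t_0$ and $T\,\Delta t\le T_{total}$. Suppose that 1. $\|\mathbf r_i^j\|\le R$ for all $i,j$, and every $X_i$ is polyhedral, i.e. a finite intersection of closed half-spaces; 2. $f$ is $C^2$, $\mu_f$-strongly convex and $L_f$-smooth (its gradient is $L_f$-Lipschitz), with minimizer $x_f^\star$; $\phi$ is $C^2$, $\mu_\phi$-strongly convex and $L_\phi$-smooth, with minimizer $z_\phi^\star$; 3. $\|x^0\|^2\le M n_x$, $\|x_f^\star\|^2\le M n_x$ and $\|z_\phi^\star\|^2\le M n_z$; 4. $\rho\ge 4L_\phi^2/\mu_\phi$, and $(x^k,z^k,w^k)_{k\ge0}$ are iterates of the ADMM whose initial point satisfies $x^0_i\in X_i$ for all $i$, $A(x^0)+z^0=0$ and $w^0=-\nabla\phi(z^0)$. Then there are constants $c_5>1$ and $r>0$ such that, as $k\to\infty$, $$L(x^k,z^k,w^k)-\min_{(x,z)\in\mathcal B(x^k,z^k;r)}L(x,z,w^k)\in\mathcal O(c_5^{-k}),$$ where $\mathcal B(x^k,z^k;r)$ is the closed Euclidean ball of $(x,z)$-space, $L(x^k,z^k,w^k)$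 is finite and the minimum is attained and finite, for every $k\ge0$. Furthermore $(x^k,z^k,w^k)$ converges to some $(x^\star,z^\star,w^\star)$, and $(x^\star,z^\star)$ is a local minimum of the locomotion problem. No differentiability of $L$ at the limit point is assumed. -/

import Mathlib

open Filter Topology Asymptotics

noncomputable section

namespace Locomotion

/-- Physical space `ℝ³` with the Euclidean norm. -/
abbrev V3 := EuclideanSpace ℝ (Fin 3)

/-- One block `x_i = (f_i^1, …, f_i^N)`: the contact forces at one time step. -/
abbrev Block (N : ℕ) := PiLp 2 (fun _ : Fin N => V3)

/-- The primal variable `x = (x_0, …, x_T)`, of dimension `n_x = 3 N (T + 1)`. -/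
abbrev Forces (N T : ℕ) := PiLp 2 (fun _ : Fin (T + 1) => Block N)

/-- The space of `z = (k'_0, …, k'_T)` and of the dual variable `w`,
of dimension `n_z = n_c = 3 (T + 1)`. -/
abbrev Momenta (T : ℕ) := PiLp 2 (fun _ : Fin (T + 1) => V3)

/-- The cross product of `ℝ³`. -/
def cross (a b : V3) : V3 := WithLp.toLp 2 (crossProduct a.ofLp b.ofLp)

/-- The physical data that do not depend on the time discretization. -/
structure Physics where
  /-- mass of the robot -/
  mass : ℝ
  /-- gravity vector -/
  gravity : V3
  /-- initial position of the center of mass -/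
  cInit : V3
  /-- initial velocity of the center of mass -/
  vInit : V3
  /-- initial angular momentum -/
  kInit : V3

/-- The data of a locomotion problem with `N` end-effectors and `T` time steps. -/
structure Problem (N T : ℕ) where
  /-- the physical constants -/
  phys : Physics
  /-- the time step `Δt` -/
  dt : ℝ
  /-- contact locations `r_i^j`, `0 ≤ i ≤ T - 1` -/
  contact : Fin T → Fin N → V3
  /-- the constraint set `X_i` of the forces at time `i` -/
  X : Fin (T + 1) → Set (Block N)
  /-- the cost of the forces -/
  f : Forces N T → ℝ
  /-- the cost of the momentum increments -/
  φ : Momenta T → ℝ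

variable {N T : ℕ}

namespace Problem

/-- The position of the center of mass at time `i` as a function of the forces,
`c_init + i Δt v_init + ∑_{i' = 0}^{i - 2} (i - 1 - i') (∑_l f_{i'}^l / m + g) Δt²`
(the sum is empty for `i = 0, 1`). -/
def comPos (P : Problem N T) (x : Forces N T) (i : ℕ) : V3 :=
  P.phys.cInit + ((i : ℝ) * P.dt) • P.phys.vInit
    + ∑ i' ∈ Finset.univ.filter (fun i' : Fin (T + 1) => (i' : ℕ) + 2 ≤ i),
        (((i : ℝ) - 1 - (i' : ℝ)) * P.dt ^ 2) •
          ((∑ l : Fin N, P.phys.mass⁻¹ • x i' l) + P.phys.gravity)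

/-- The right-hand sides of the constraints: `k'_0 = k_init` and
`k'_{i+1} = ∑_j ((r_i^j - c_i(f)) × f_i^j) Δt` for `0 ≤ i ≤ T - 1`. -/
def momentum (P : Problem N T) (x : Forces N T) : Momenta T :=
  WithLp.toLp 2 (Fin.cons P.phys.kInit (fun i : Fin T =>
    P.dt • ∑ j : Fin N, cross (P.contact i j - P.comPos x i) (x i.castSucc j)))

/-- The residual `A(x) + Q z` of the constraints, with `Q` the identity and
`A(x)` the negative of the right-hand sides. -/
def residual (P : Problem N T) (x : Forces N T) (z : Momenta T) : Momenta T :=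
  - P.momentum x + z

end Problem

/-- The indicator function of a set in the sense of convex analysis: `0` on `S`, `+∞` off `S`. -/
def indicatorFn {E : Type*} (S : Set E) (y : E) : EReal :=
  open Classical in if y ∈ S then 0 else ⊤

namespace Problem

/-- The objective `f(x) + φ(z) + ∑_i I_i(x_i)`. -/
def objective (P : Problem N T) (x : Forces N T) (z : Momenta T) : EReal :=
  ((P.f x + P.φ z : ℝ) : EReal) + ∑ i, indicatorFn (P.X i) (x i)

/-- The set of the pairs `(x, z)` that satisfy the equality constraints. -/
def constraintSet (P : Problem N T) : Set (Forces N T × Momenta T) :=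
  {p | P.residual p.1 p.2 = 0}

/-- `(x, z)` is a local minimum of the locomotion problem: it is feasible, with finite objective,
and it minimizes the objective among the points of the constraint set near it. -/
def IsLocalMinimum (P : Problem N T) (x : Forces N T) (z : Momenta T) : Prop :=
  (x, z) ∈ P.constraintSet ∧ (∀ i, x i ∈ P.X i) ∧
    IsLocalMinOn (fun p : Forces N T × Momenta T => P.objective p.1 p.2) P.constraintSet (x, z)

/-- The augmented Lagrangian with penalty parameter `ρ`. -/
def lagrangian (P : Problem N T) (ρ : ℝ) (x : Forces N T) (z w : Momenta T) : EReal :=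
  P.objective x z
    + ((inner ℝ w (P.residual x z) + ρ / 2 * ‖P.residual x z‖ ^ 2 : ℝ) : EReal)

end Problem

/-- The point whose blocks before `i` are those of `x'`, whose block `i` is `y`, and whose blocks
after `i` are those of `x`. -/
def splice (x' x : Forces N T) (i : Fin (T + 1)) (y : Block N) : Forces N T :=
  WithLp.toLp 2 (fun j => if j < i then x' j else if j = i then y else x j)

/-- `(x^k, z^k, w^k)` is a sequence of iterates of the ADMM with penalty parameter `ρ`. -/
structure IsADMM (P : Problem N T) (ρ : ℝ) (x : ℕ → Forces N T) (z w : ℕ → Momenta T) :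
    Prop where
  x_step : ∀ k i, IsMinOn (fun y => P.lagrangian ρ (splice (x (k + 1)) (x k) i y) (z k) (w k))
    Set.univ (x (k + 1) i)
  z_step : ∀ k, IsMinOn (fun ζ => P.lagrangian ρ (x (k + 1)) ζ (w k)) Set.univ (z (k + 1))
  w_step : ∀ k, w (k + 1) = w k + ρ • P.residual (x (k + 1)) (z (k + 1))

/-- The closed Euclidean ball of radius `r` around `(x, z)` in the product space. -/
def ball (x : Forces N T) (z : Momenta T) (r : ℝ) : Set (Forces N T × Momenta T) :=
  {p | ‖p.1 - x‖ ^ 2 + ‖p.2 - z‖ ^ 2 ≤ r ^ 2}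

/-- A polyhedral set: a finite intersection of closed half-spaces. -/
def IsPolyhedral {E : Type*} [NormedAddCommGroup E] [InnerProductSpace ℝ E] (S : Set E) : Prop :=
  ∃ (n : ℕ) (a : Fin n → E) (b : Fin n → ℝ), S = {y | ∀ l, inner ℝ (a l) y ≤ b l}

/-- `g` is `L`-smooth: its gradient is `L`-Lipschitz (used for differentiable `g`). -/
def IsSmooth {E : Type*} [NormedAddCommGroup E] [InnerProductSpace ℝ E] [CompleteSpace E]
    (L : ℝ) (g : E → ℝ) : Prop :=
  ∀ y y', ‖gradient g y - gradient g y'‖ ≤ L * ‖y - y'‖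

end Locomotion

end

noncomputable section

namespace Locomotion

/-! ### First-order consequences of strong convexity and smoothness. -/

section Gradient

variable {E : Type*} [NormedAddCommGroup E] [InnerProductSpace ℝ E] [CompleteSpace E]

/-! Since `c_i` is affine in the forces of the steps up to `i - 2` and the cross product is
bilinear, the constraint reads z = q(x) with q(x) = b + ℓ x + B(x, x), where B(h, h) = 0 for every h
supported in a single block (`momBil_single_single`). Each block subproblem is therefore strongly
convex, and a sweep over the blocks lowers the augmented Lagrangian by at least (μ_f/2)‖Δx‖².
Optimality in z and the dual update give w = -∇φ(z), so the residual is at most (L_φ/ρ)‖Δz‖; the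
bound on ρ then makes the rise caused by the dual step at most half of the gain of the z step
(`smoothLag_succ_add_le`).

The identity w = -∇φ(z) also bounds the augmented Lagrangian from below by a coercive function
(`le_augLag_of_dual_eq`), so ‖w‖² is controlled by the excess energy of the initial point, which is
O(T + 1) uniformly in the discretization (`initial_energy_le`). On the other hand ‖B(h, h)‖² =
O(Δt³)‖h‖⁴ (`sq_norm_momBil_le`). As (T + 1)Δt stays bounded, ‖w‖‖B(h, h)‖ = O(Δt)‖h‖², which is at
most (μ_f/4)‖h‖² for small Δt: the strong convexity of f dominates the curvature of the constraint.

Approximate stationarity hence implies approximate global minimality: the Lagrangian at an iterate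
exceeds its infimum over all admissible points by at most C(‖Δx‖² + ‖Δz‖²) (`exists_gap_bound`).
Together with the sufficient decrease this forces geometric decay (`exists_linear_convergence`),
with no Łojasiewicz-type inequality. The limit even minimizes the objective over the whole feasible
set. -/

theorem tendsto_slope_inner_gradient {g : E → ℝ} {x : E} (hg : DifferentiableAt ℝ g x) (h : E) :
    Tendsto (fun t : ℝ => (g (x + t • h) - g x) / t) (𝓝[>] 0) (𝓝 (inner ℝ (gradient g x) h)) := by
  have hx : HasDerivAt (fun t : ℝ => g (x + t • h)) (fderiv ℝ g x h) 0 := by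
    have h1 : HasDerivAt (fun t : ℝ => x + t • h) h 0 := by
      simpa using ((hasDerivAt_id (0 : ℝ)).smul_const h).const_add x
    have h2 : HasFDerivAt g (fderiv ℝ g x) (x + (0 : ℝ) • h) := by simpa using hg.hasFDerivAt
    exact h2.comp_hasDerivAt 0 h1
  rw [inner_gradient_left]
  have := hx.tendsto_slope_zero_right
  refine this.congr fun t => ?_
  simp [div_eq_inv_mul]

/-- One-sided first-order optimality along a segment on which the rest of the objective is a
quadratic polynomial of the parameter. -/
theorem inner_gradient_add_nonneg {g : E → ℝ} {x h : E} (hg : DifferentiableAt ℝ g x) {a b : ℝ}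
    (hmin : ∀ t : ℝ, 0 < t → t ≤ 1 → 0 ≤ g (x + t • h) - g x + t * a + t ^ 2 * b) :
    0 ≤ inner ℝ (gradient g x) h + a := by
  have h1 := tendsto_slope_inner_gradient hg h
  have h2 : Tendsto (fun t : ℝ => a + t * b) (𝓝[>] 0) (𝓝 a) := by
    have : Tendsto (fun t : ℝ => a + t * b) (𝓝 0) (𝓝 (a + 0 * b)) :=
      (continuous_const.add (continuous_id.mul continuous_const)).tendsto 0
    simpa using this.mono_left nhdsWithin_le_nhds
  refine ge_of_tendsto (h1.add h2) ?_
  filter_upwards [Ioc_mem_nhdsGT (zero_lt_one (α := ℝ))] with t ht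
  have h3 := hmin t ht.1 ht.2
  have ht0 := ht.1
  have : (g (x + t • h) - g x) / t + (a + t * b)
      = (g (x + t • h) - g x + t * a + t ^ 2 * b) / t := by
    field_simp
    ring
  rw [this]
  positivity

/-- Divide the strong convexity inequality at x + t(y - x) by t and let t → 0⁺. -/
theorem add_inner_gradient_add_le_of_strongConvexOn {g : E → ℝ} {μ : ℝ}
    (hc : StrongConvexOn Set.univ μ g) {x : E} (hg : DifferentiableAt ℝ g x) (y : E) :
    g x + inner ℝ (gradient g x) (y - x) + μ / 2 * ‖y - x‖ ^ 2 ≤ g y := by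
  have h1 := tendsto_slope_inner_gradient hg (y - x)
  have h2 : Tendsto (fun t : ℝ => g y - g x - (1 - t) * (μ / 2 * ‖y - x‖ ^ 2)) (𝓝[>] 0)
      (𝓝 (g y - g x - (1 - 0) * (μ / 2 * ‖y - x‖ ^ 2))) := by
    refine Tendsto.mono_left (Continuous.tendsto ?_ 0) nhdsWithin_le_nhds
    fun_prop
  have := le_of_tendsto_of_tendsto h1 h2 (by
    filter_upwards [Ioc_mem_nhdsGT (zero_lt_one (α := ℝ))] with t ht
    have h3 := hc.2 (Set.mem_univ x) (Set.mem_univ y) (sub_nonneg.2 ht.2) ht.1.le (by ring)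
    have h4 : (1 - t) • x + t • y = x + t • (y - x) := by module
    rw [h4] at h3
    rw [div_le_iff₀ ht.1, norm_sub_rev y x]
    simp only [smul_eq_mul] at h3
    linarith)
  linarith

theorem gradient_eq_zero_of_isMinOn {g : E → ℝ} {x : E} (hx : IsMinOn g Set.univ x) :
    gradient g x = 0 := by
  have : fderiv ℝ g x = 0 := (hx.isLocalMin Filter.univ_mem).fderiv_eq_zero
  simp [gradient, this]

theorem IsSmooth.norm_gradient_le {g : E → ℝ} {L : ℝ} (hL : IsSmooth L g) {x : E}
    (hx : IsMinOn g Set.univ x) (y : E) : ‖gradient g y‖ ≤ L * ‖y - x‖ := by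
  simpa [gradient_eq_zero_of_isMinOn hx] using hL y x

theorem add_le_of_strongConvexOn_of_isMinOn {g : E → ℝ} {μ : ℝ}
    (hc : StrongConvexOn Set.univ μ g) (hg : Differentiable ℝ g) {x : E}
    (hx : IsMinOn g Set.univ x) (y : E) : g x + μ / 2 * ‖y - x‖ ^ 2 ≤ g y := by
  simpa [gradient_eq_zero_of_isMinOn hx] using
    add_inner_gradient_add_le_of_strongConvexOn hc (hg x) y

/-- Convexity at y bounds the excess by ⟨∇g(y), y - x⟩, and ∇g vanishes at x. This avoids
integrating the gradient, at the price of L in place of L/2. -/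
theorem sub_le_of_isSmooth_of_isMinOn {g : E → ℝ} {μ L : ℝ} (hμ : 0 ≤ μ)
    (hc : StrongConvexOn Set.univ μ g) (hg : Differentiable ℝ g) (hL : IsSmooth L g) {x : E}
    (hx : IsMinOn g Set.univ x) (y : E) : g y - g x ≤ L * ‖y - x‖ ^ 2 := by
  have h1 := add_inner_gradient_add_le_of_strongConvexOn hc (hg y) x
  have h2 := hL.norm_gradient_le hx y
  have h3 := abs_le.1 (abs_real_inner_le_norm (gradient g y) (x - y))
  rw [norm_sub_rev x y] at h1 h3
  have h4 : ‖gradient g y‖ * ‖y - x‖ ≤ L * ‖y - x‖ * ‖y - x‖ :=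
    mul_le_mul_of_nonneg_right h2 (norm_nonneg _)
  have h5 : 0 ≤ μ / 2 * ‖y - x‖ ^ 2 := by positivity
  nlinarith [h3.1]

theorem IsSmooth.continuous_gradient {g : E → ℝ} {L : ℝ} (hL : IsSmooth L g) :
    Continuous (gradient g) := by
  refine (LipschitzWith.of_dist_le_mul (K := L.toNNReal) fun x y => ?_).continuous
  rw [dist_eq_norm, dist_eq_norm]
  exact (hL x y).trans (mul_le_mul_of_nonneg_right (Real.le_coe_toNNReal L) (norm_nonneg _))

end Gradient

/-! ### Linear convergence from sufficient decrease. -/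

section Sequences

/-- A sequence that decreases by at least `a D_k`, and whose excess over its limit is at most
`C D_k`, makes `D_k` decay geometrically. -/
theorem exists_geometric_bound {l D : ℕ → ℝ} {a C s : ℝ} (ha : 0 < a) (hC : 0 ≤ C)
    (hD : ∀ k, 0 ≤ D k) (hdec : ∀ k, l (k + 1) + a * D k ≤ l k) (hlim : Tendsto l atTop (𝓝 s))
    (hgap : ∀ k, l (k + 1) ≤ s + C * D k) :
    ∃ θ K : ℝ, 0 < θ ∧ θ < 1 ∧ 0 ≤ K ∧ ∀ k, D k ≤ K * θ ^ k := by
  have hanti : Antitone l := antitone_nat_of_succ_le fun k => by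
    have := mul_nonneg ha.le (hD k)
    linarith [hdec k]
  have hs : ∀ k, s ≤ l k := fun k => hanti.le_of_tendsto hlim k
  -- The excess e over the limit satisfies e_{k+1} ≤ q (e_k - e_{k+1}), whence the ratio q/(q + 1).
  -- Using C + 1 keeps q positive when C = 0.
  set q : ℝ := (C + 1) / a with hq
  have hq0 : 0 < q := by positivity
  refine ⟨q / (q + 1), (l 0 - s) / a, by positivity, by rw [div_lt_one (by positivity)]; linarith,
    div_nonneg (sub_nonneg.2 (hs 0)) ha.le, ?_⟩
  have hE : ∀ k, l k - s ≤ (l 0 - s) * (q / (q + 1)) ^ k := by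
    intro k
    induction k with
    | zero => simp
    | succ k ih =>
      have h1 : l (k + 1) - s ≤ q * (l k - l (k + 1)) := by
        have h2 : q * (a * D k) ≤ q * (l k - l (k + 1)) :=
          mul_le_mul_of_nonneg_left (by linarith [hdec k]) hq0.le
        have h3 : q * (a * D k) = (C + 1) * D k := by rw [hq]; field_simp
        nlinarith [hgap k, hD k]
      have h4 : l (k + 1) - s ≤ q / (q + 1) * (l k - s) := by
        rw [div_mul_eq_mul_div, le_div_iff₀ (by positivity)]
        linarith
      calc l (k + 1) - s ≤ q / (q + 1) * (l k - s) := h4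
        _ ≤ q / (q + 1) * ((l 0 - s) * (q / (q + 1)) ^ k) :=
          mul_le_mul_of_nonneg_left ih (by positivity)
        _ = _ := by ring
  intro k
  have h1 : a * D k ≤ l k - s := by linarith [hdec k, hs (k + 1)]
  rw [div_mul_eq_mul_div, le_div_iff₀ ha]
  linarith [hE k]

/-- The increments are dominated by a geometric series of ratio √θ, so the sequence is Cauchy. -/
theorem exists_tendsto_of_sq_norm_sub_le {E : Type*} [NormedAddCommGroup E] [CompleteSpace E]
    {u : ℕ → E} {θ K : ℝ} (hθ : 0 < θ) (hθ1 : θ < 1) (hK : 0 ≤ K)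
    (hu : ∀ k, ‖u (k + 1) - u k‖ ^ 2 ≤ K * θ ^ k) : ∃ u', Tendsto u atTop (𝓝 u') := by
  refine cauchySeq_tendsto_of_complete
    (cauchySeq_of_le_geometric (Real.sqrt θ) (Real.sqrt K) ?_ fun k => ?_)
  · rw [Real.sqrt_lt' one_pos]; simpa using hθ1
  · rw [dist_comm, dist_eq_norm]
    refine abs_le_of_sq_le_sq' ?_ (by positivity) |>.2
    rw [mul_pow, ← pow_mul, mul_comm k, pow_mul, Real.sq_sqrt hK, Real.sq_sqrt hθ.le]
    exact hu k

end Sequences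

variable {N T : ℕ}

instance : ContinuousSMul ℝ (Forces N T) := IsBoundedSMul.continuousSMul

instance : ContinuousSMul ℝ (Momenta T) := IsBoundedSMul.continuousSMul

/-! ### Bilinearity and norm of the cross product. -/

section Cross

theorem cross_add_left (a a' b : V3) : cross (a + a') b = cross a b + cross a' b := by
  simp [cross]

theorem cross_add_right (a b b' : V3) : cross a (b + b') = cross a b + cross a b' := by
  simp [cross]

theorem cross_smul_left (t : ℝ) (a b : V3) : cross (t • a) b = t • cross a b := by
  simp [cross]

theorem cross_smul_right (t : ℝ) (a b : V3) : cross a (t • b) = t • cross a b := by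
  simp [cross]

theorem cross_zero_left (b : V3) : cross 0 b = 0 := by
  simp [cross]

theorem cross_zero_right (a : V3) : cross a 0 = 0 := by
  simp [cross]

theorem norm_cross_le (a b : V3) : ‖cross a b‖ ≤ ‖a‖ * ‖b‖ := by
  refine abs_le_of_sq_le_sq' ?_ (by positivity) |>.2
  rw [mul_pow, EuclideanSpace.real_norm_sq_eq, EuclideanSpace.real_norm_sq_eq,
    EuclideanSpace.real_norm_sq_eq]
  simp only [cross, cross_apply, Fin.sum_univ_three, Matrix.cons_val]
  -- Lagrange's identity: ‖a‖²‖b‖² - ‖a × b‖² = ⟨a, b⟩².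
  nlinarith [sq_nonneg (a 0 * b 0 + a 1 * b 1 + a 2 * b 2)]

end Cross

/-! ### Norm estimates for blocks of forces and momenta. -/

section Norms

/-- The sum of the norms of the contact forces of one time step. -/
def forceSum (y : Block N) : ℝ := ∑ l, ‖y l‖

theorem forceSum_nonneg (y : Block N) : 0 ≤ forceSum y :=
  Finset.sum_nonneg fun _ _ => norm_nonneg _

theorem sq_forceSum_le (y : Block N) : forceSum y ^ 2 ≤ N * ‖y‖ ^ 2 := by
  have := sq_sum_le_card_mul_sum_sq (s := Finset.univ) (f := fun l => ‖y l‖)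
  rw [PiLp.norm_sq_eq_of_L2]
  simpa [forceSum] using this

theorem sum_sq_forceSum_le (x : Forces N T) : ∑ i, forceSum (x i) ^ 2 ≤ N * ‖x‖ ^ 2 := by
  rw [PiLp.norm_sq_eq_of_L2, Finset.mul_sum]
  exact Finset.sum_le_sum fun i _ => sq_forceSum_le _

theorem sq_sum_forceSum_le (x : Forces N T) :
    (∑ i, forceSum (x i)) ^ 2 ≤ (T + 1) * (N * ‖x‖ ^ 2) := by
  have := sq_sum_le_card_mul_sum_sq (s := Finset.univ) (f := fun i => forceSum (x i))
  refine this.trans ?_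
  simp only [Finset.card_univ, Fintype.card_fin, Nat.cast_add, Nat.cast_one]
  exact mul_le_mul_of_nonneg_left (sum_sq_forceSum_le x) (by positivity)

theorem norm_sum_cross_le (a : Fin N → V3) {A : ℝ} (ha : ∀ j, ‖a j‖ ≤ A) (y : Block N) :
    ‖∑ j, cross (a j) (y j)‖ ≤ A * forceSum y := by
  rw [forceSum, Finset.mul_sum]
  exact norm_sum_le_of_le _ fun j _ =>
    (norm_cross_le _ _).trans (mul_le_mul_of_nonneg_right (ha j) (norm_nonneg _))

/-- The element of the momentum space whose block `0` is `a` and whose block `i + 1` is `v i`. -/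
def consMomenta (a : V3) (v : Fin T → V3) : Momenta T := WithLp.toLp 2 (Fin.cons a v)

theorem sq_norm_consMomenta (a : V3) (v : Fin T → V3) :
    ‖consMomenta a v‖ ^ 2 = ‖a‖ ^ 2 + ∑ i, ‖v i‖ ^ 2 := by
  rw [PiLp.norm_sq_eq_of_L2, Fin.sum_univ_succ]
  simp [consMomenta]

theorem consMomenta_add (a b : V3) (u v : Fin T → V3) :
    consMomenta (a + b) (fun i => u i + v i) = consMomenta a u + consMomenta b v := by
  ext i : 1
  refine Fin.cases ?_ (fun i => ?_) i <;> simp [consMomenta]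

theorem consMomenta_smul (t : ℝ) (v : Fin T → V3) :
    consMomenta 0 (fun i => t • v i) = t • consMomenta 0 v := by
  ext i : 1
  refine Fin.cases ?_ (fun i => ?_) i <;> simp [consMomenta]

theorem sq_norm_consMomenta_zero_le {v : Fin T → V3} {x : Forces N T} {A : ℝ}
    (hv : ∀ i, ‖v i‖ ≤ A * forceSum (x i.castSucc)) :
    ‖consMomenta 0 v‖ ^ 2 ≤ A ^ 2 * (N * ‖x‖ ^ 2) := by
  rw [sq_norm_consMomenta, norm_zero]
  calc (0 : ℝ) ^ 2 + ∑ i, ‖v i‖ ^ 2 ≤ ∑ i : Fin T, A ^ 2 * forceSum (x i.castSucc) ^ 2 := by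
        rw [zero_pow two_ne_zero, zero_add]
        refine Finset.sum_le_sum fun i _ => ?_
        rw [← mul_pow]
        exact pow_le_pow_left₀ (norm_nonneg _) (hv i) 2
    _ ≤ ∑ i, A ^ 2 * forceSum (x i) ^ 2 := by
        -- The last force block produces no momentum increment; including it only enlarges the sum.
        rw [Fin.sum_univ_castSucc (n := T)]
        have : 0 ≤ A ^ 2 * forceSum (x (Fin.last T)) ^ 2 := by positivity
        linarith
    _ ≤ A ^ 2 * (N * ‖x‖ ^ 2) := by
        rw [← Finset.mul_sum]
        exact mul_le_mul_of_nonneg_left (sum_sq_forceSum_le x) (by positivity)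

end Norms

/-! ### The constraint map as a quadratic map, with bounds in terms of Δt. -/

namespace Problem

/-- The linear part of the affine function `comPos`. -/
def comLin (P : Problem N T) (x : Forces N T) (i : ℕ) : V3 :=
  ∑ i' ∈ Finset.univ.filter (fun i' : Fin (T + 1) => (i' : ℕ) + 2 ≤ i),
    (((i : ℝ) - 1 - (i' : ℝ)) * P.dt ^ 2) • (∑ l : Fin N, P.phys.mass⁻¹ • x i' l)

theorem comPos_eq (P : Problem N T) (x : Forces N T) (i : ℕ) :
    P.comPos x i = P.comPos 0 i + P.comLin x i := by
  simp only [comPos, comLin, smul_add, Finset.sum_add_distrib, PiLp.zero_apply, smul_zero,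
    Finset.sum_const_zero, zero_add]
  abel

theorem comLin_add (P : Problem N T) (x y : Forces N T) (i : ℕ) :
    P.comLin (x + y) i = P.comLin x i + P.comLin y i := by
  simp only [comLin, PiLp.add_apply, smul_add, Finset.sum_add_distrib]

theorem comLin_smul (P : Problem N T) (t : ℝ) (x : Forces N T) (i : ℕ) :
    P.comLin (t • x) i = t • P.comLin x i := by
  simp only [comLin, PiLp.smul_apply, Finset.smul_sum, smul_smul]
  refine Finset.sum_congr rfl fun _ _ => Finset.sum_congr rfl fun _ _ => ?_
  congr 1
  ring

/-- The position at time i involves only blocks of index at most i - 2, so perturbing block i does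
not move it. -/
theorem comLin_single (P : Problem N T) (i : Fin (T + 1)) (v : Block N) :
    P.comLin (PiLp.single 2 i v) i = 0 := by
  refine Finset.sum_eq_zero fun i' hi' => ?_
  have hne : i' ≠ i := by
    rintro rfl
    simp at hi'
  rw [PiLp.single_eq_of_ne 2 hne]
  simp

/-- The momentum increments `∑_j (a_i^j × y_i^j) Δt` for the lever arms `a_i^j`. -/
def torque (P : Problem N T) (a : Fin T → Fin N → V3) (y : Forces N T) : Momenta T :=
  consMomenta 0 fun i => P.dt • ∑ j, cross (a i j) (y i.castSucc j)

theorem torque_add_left (P : Problem N T) (a b : Fin T → Fin N → V3) (y : Forces N T) :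
    P.torque (a + b) y = P.torque a y + P.torque b y := by
  rw [torque, torque, torque, ← consMomenta_add, add_zero]
  simp only [Pi.add_apply, cross_add_left, Finset.sum_add_distrib, smul_add]

theorem torque_smul_left (P : Problem N T) (t : ℝ) (a : Fin T → Fin N → V3) (y : Forces N T) :
    P.torque (t • a) y = t • P.torque a y := by
  rw [torque, torque, ← consMomenta_smul]
  simp only [Pi.smul_apply, cross_smul_left, ← Finset.smul_sum, smul_comm t]

theorem torque_add_right (P : Problem N T) (a : Fin T → Fin N → V3) (x y : Forces N T) :
    P.torque a (x + y) = P.torque a x + P.torque a y := by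
  rw [torque, torque, torque, ← consMomenta_add, add_zero]
  simp only [PiLp.add_apply, cross_add_right, Finset.sum_add_distrib, smul_add]

theorem torque_smul_right (P : Problem N T) (t : ℝ) (a : Fin T → Fin N → V3) (y : Forces N T) :
    P.torque a (t • y) = t • P.torque a y := by
  rw [torque, torque, ← consMomenta_smul]
  simp only [PiLp.smul_apply, cross_smul_right, ← Finset.smul_sum, smul_comm t]

/-- The linear part of the momentum increments, as a linear map. -/
def momLinₗ (P : Problem N T) : Forces N T →ₗ[ℝ] Momenta T where
  toFun := P.torque fun i j => P.contact i j - P.comPos 0 i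
  map_add' := P.torque_add_right _
  map_smul' t := P.torque_smul_right t _

/-- The linear part of the momentum increments. -/
def momLin (P : Problem N T) : Forces N T →L[ℝ] Momenta T :=
  P.momLinₗ.toContinuousLinearMap

theorem momLin_apply (P : Problem N T) (y : Forces N T) :
    P.momLin y = P.torque (fun i j => P.contact i j - P.comPos 0 i) y := rfl

/-- The lever arms that the linear part of the center of mass contributes. -/
def comArm (P : Problem N T) (x : Forces N T) : Fin T → Fin N → V3 := fun i _ => -P.comLin x i

theorem comArm_add (P : Problem N T) (x y : Forces N T) :
    P.comArm (x + y) = P.comArm x + P.comArm y := by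
  funext i _
  simp only [comArm, comLin_add, Pi.add_apply, neg_add]

theorem comArm_smul (P : Problem N T) (t : ℝ) (x : Forces N T) :
    P.comArm (t • x) = t • P.comArm x := by
  funext i _
  simp only [comArm, comLin_smul, Pi.smul_apply, smul_neg]

/-- The bilinear part of the momentum increments, as a bilinear map. -/
def momBilₗ (P : Problem N T) : Forces N T →ₗ[ℝ] Forces N T →ₗ[ℝ] Momenta T :=
  LinearMap.mk₂ ℝ (fun x y => P.torque (P.comArm x) y)
    (fun x x' y => by rw [comArm_add, torque_add_left])
    (fun t x y => by rw [comArm_smul, torque_smul_left])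
    (fun x y y' => P.torque_add_right _ y y')
    (fun t x y => P.torque_smul_right t _ y)

/-- The bilinear part of the momentum increments. -/
def momBil (P : Problem N T) : Forces N T →L[ℝ] Forces N T →L[ℝ] Momenta T :=
  P.momBilₗ.toContinuousBilinearMap

theorem momBil_apply (P : Problem N T) (x y : Forces N T) :
    P.momBil x y = P.torque (P.comArm x) y := rfl

/-- Splitting the position into its value at zero forces and its linear part splits each cross
product into a linear and a bilinear term. -/
theorem momentum_eq (P : Problem N T) (x : Forces N T) :
    P.momentum x = consMomenta P.phys.kInit 0 + P.momLin x + P.momBil x x := by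
  rw [momLin_apply, momBil_apply, momentum, torque, torque]
  ext i : 1
  refine Fin.cases ?_ (fun i => ?_) i
  · simp [consMomenta]
  · simp only [consMomenta, comArm, PiLp.add_apply, Fin.cons_succ, Pi.zero_apply, zero_add, ← smul_add,
      ← Finset.sum_add_distrib, ← cross_add_left, P.comPos_eq x]
    congr 1
    refine Finset.sum_congr rfl fun j _ => ?_
    congr 1
    abel

/-- Row k multiplies the force of block k by a lever arm depending on earlier blocks only. For a
vector supported in block i the force vanishes in every row but row i, and there the lever arm
vanishes. This is what makes the block subproblems convex. -/
theorem momBil_single_single (P : Problem N T) (i : Fin (T + 1)) (v : Block N) :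
    P.momBil (PiLp.single 2 i v) (PiLp.single 2 i v) = 0 := by
  rw [momBil_apply, torque]
  have : (fun k : Fin T => P.dt • ∑ j, cross (P.comArm (PiLp.single 2 i v) k j)
      ((PiLp.single 2 i v : Forces N T) k.castSucc j)) = fun _ => (0 : V3) := by
    funext k
    by_cases hk : k.castSucc = i
    · have h := P.comLin_single i v
      rw [← hk, Fin.val_castSucc, hk] at h
      simp [comArm, h, cross_zero_left]
    · rw [PiLp.single_eq_of_ne 2 hk]
      simp [cross_zero_right]
  rw [this]
  ext i : 1
  refine Fin.cases ?_ (fun i => ?_) i <;> simp [consMomenta]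

/-- Each weight is at most T Δt² ≤ τ Δt, so one power of Δt survives. -/
theorem norm_comLin_le (P : Problem N T) {τ : ℝ} (hm : 0 < P.phys.mass) (hdt : 0 < P.dt)
    (hτ : (T : ℝ) * P.dt ≤ τ) (x : Forces N T) {i : ℕ} (hi : i ≤ T) :
    ‖P.comLin x i‖ ≤ τ * P.dt / P.phys.mass * ∑ i', forceSum (x i') := by
  rw [Finset.mul_sum]
  have hτ0 : 0 ≤ τ := le_trans (by positivity) hτ
  refine (norm_sum_le _ _).trans ((Finset.sum_le_sum fun i' hi' => ?_).trans
    (Finset.sum_le_sum_of_subset_of_nonneg (Finset.subset_univ _)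
      fun i' _ _ => mul_nonneg (by positivity) (forceSum_nonneg _)))
  rw [norm_smul, ← Finset.smul_sum, norm_smul, ← mul_assoc]
  have hi2 : ((i' : ℕ) : ℝ) + 2 ≤ i := by
    exact_mod_cast (Finset.mem_filter.1 hi').2
  have hiT : (i : ℝ) ≤ T := by exact_mod_cast hi
  have hi0 : (0 : ℝ) ≤ (i' : ℕ) := Nat.cast_nonneg _
  refine mul_le_mul ?_ (norm_sum_le _ _) (norm_nonneg _) (by positivity)
  rw [Real.norm_of_nonneg (mul_nonneg (by linarith) (by positivity)),
    Real.norm_of_nonneg (by positivity), div_eq_mul_inv]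
  refine mul_le_mul_of_nonneg_right ?_ (by positivity)
  calc ((i : ℝ) - 1 - (i' : ℕ)) * P.dt ^ 2 ≤ T * P.dt ^ 2 :=
        mul_le_mul_of_nonneg_right (by linarith) (by positivity)
    _ = T * P.dt * P.dt := by ring
    _ ≤ τ * P.dt := mul_le_mul_of_nonneg_right hτ hdt.le

/-- Gravity contributes at most T + 1 terms of size O(Δt), hence a bounded amount. -/
theorem norm_comPos_zero_le (P : Problem N T) {τ : ℝ} (hdt : 0 < P.dt) (hdt1 : P.dt ≤ 1)
    (hτ : (T : ℝ) * P.dt ≤ τ) {i : ℕ} (hi : i ≤ T) :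
    ‖P.comPos 0 i‖ ≤ ‖P.phys.cInit‖ + τ * ‖P.phys.vInit‖ + (τ + 1) * τ * ‖P.phys.gravity‖ := by
  have hτ0 : 0 ≤ τ := le_trans (by positivity) hτ
  have hiT : (i : ℝ) ≤ T := by exact_mod_cast hi
  refine (norm_add_le _ _).trans (add_le_add ((norm_add_le _ _).trans (add_le_add le_rfl ?_)) ?_)
  · rw [norm_smul, Real.norm_of_nonneg (by positivity)]
    refine mul_le_mul_of_nonneg_right (le_trans ?_ hτ) (norm_nonneg _)
    exact mul_le_mul_of_nonneg_right hiT hdt.le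
  · have hb : ∀ i' ∈ Finset.univ.filter (fun i' : Fin (T + 1) => (i' : ℕ) + 2 ≤ i),
        ‖(((i : ℝ) - 1 - (i' : ℝ)) * P.dt ^ 2) •
          ((∑ l : Fin N, P.phys.mass⁻¹ • (0 : Forces N T) i' l) + P.phys.gravity)‖
          ≤ τ * P.dt * ‖P.phys.gravity‖ := by
      intro i' hi'
      have hi2 : ((i' : ℕ) : ℝ) + 2 ≤ i := by
        exact_mod_cast (Finset.mem_filter.1 hi').2
      have hi0 : (0 : ℝ) ≤ (i' : ℕ) := Nat.cast_nonneg _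
      rw [norm_smul, Real.norm_of_nonneg (mul_nonneg (by linarith) (by positivity))]
      simp only [PiLp.zero_apply, smul_zero, Finset.sum_const_zero, zero_add]
      refine mul_le_mul_of_nonneg_right ?_ (norm_nonneg _)
      calc ((i : ℝ) - 1 - (i' : ℕ)) * P.dt ^ 2 ≤ T * P.dt ^ 2 :=
            mul_le_mul_of_nonneg_right (by linarith) (by positivity)
        _ = T * P.dt * P.dt := by ring
        _ ≤ τ * P.dt := mul_le_mul_of_nonneg_right hτ hdt.le
    refine (norm_sum_le_of_le _ hb).trans ?_
    rw [Finset.sum_const, nsmul_eq_mul, ← mul_assoc]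
    refine mul_le_mul_of_nonneg_right ?_ (norm_nonneg _)
    have hcard : ((Finset.univ.filter (fun i' : Fin (T + 1) => (i' : ℕ) + 2 ≤ i)).card : ℝ)
        ≤ T + 1 := by
      exact_mod_cast (Finset.card_le_univ _).trans (by simp)
    calc _ ≤ ((T : ℝ) + 1) * (τ * P.dt) := mul_le_mul_of_nonneg_right hcard (by positivity)
      _ = (T * P.dt + P.dt) * τ := by ring
      _ ≤ (τ + 1) * τ := mul_le_mul_of_nonneg_right (by linarith) hτ0

theorem sq_norm_momLin_le (P : Problem N T) {R C : ℝ} (hdt : 0 < P.dt)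
    (hR : ∀ i j, ‖P.contact i j‖ ≤ R) (hC : ∀ i ≤ T, ‖P.comPos 0 i‖ ≤ C) (x : Forces N T) :
    ‖P.momLin x‖ ^ 2 ≤ (P.dt * (R + C)) ^ 2 * (N * ‖x‖ ^ 2) := by
  rw [momLin_apply, torque]
  refine sq_norm_consMomenta_zero_le fun i => ?_
  rw [norm_smul, Real.norm_of_nonneg hdt.le, mul_assoc]
  refine mul_le_mul_of_nonneg_left (norm_sum_cross_le _ (fun j => ?_) _) hdt.le
  exact (norm_sub_le _ _).trans (add_le_add (hR i j) (hC i i.2.le))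

/-- One Δt comes from the momentum increment and one from the lever arm, so the square carries Δt⁴.
Cauchy–Schwarz over the time steps costs a factor T + 1, which absorbs one Δt and leaves Δt³. -/
theorem sq_norm_momBil_le (P : Problem N T) {τ : ℝ} (hm : 0 < P.phys.mass) (hdt : 0 < P.dt)
    (hdt1 : P.dt ≤ 1) (hτ : (T : ℝ) * P.dt ≤ τ) (x y : Forces N T) :
    ‖P.momBil x y‖ ^ 2 ≤
      (τ / P.phys.mass * N) ^ 2 * (τ + 1) * P.dt ^ 3 * (‖x‖ ^ 2 * ‖y‖ ^ 2) := by
  have hτ0 : 0 ≤ τ := le_trans (by positivity) hτ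
  rw [momBil_apply, torque]
  have h1 := sq_norm_consMomenta_zero_le (x := y)
    (v := fun i : Fin T => P.dt • ∑ j, cross (P.comArm x i j) (y i.castSucc j))
    (A := P.dt * (τ * P.dt / P.phys.mass * ∑ i', forceSum (x i'))) fun i => by
      rw [norm_smul, Real.norm_of_nonneg hdt.le, mul_assoc]
      refine mul_le_mul_of_nonneg_left (norm_sum_cross_le _ (fun j => ?_) _) hdt.le
      rw [comArm, norm_neg]
      exact P.norm_comLin_le hm hdt hτ x i.2.le
  refine h1.trans ?_
  have h2 := sq_sum_forceSum_le x
  have h3 : ((T : ℝ) + 1) * P.dt ≤ τ + 1 := by linarith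
  calc (P.dt * (τ * P.dt / P.phys.mass * ∑ i', forceSum (x i'))) ^ 2 * (N * ‖y‖ ^ 2)
      = P.dt ^ 4 * (τ / P.phys.mass) ^ 2 * (N * ‖y‖ ^ 2) * (∑ i', forceSum (x i')) ^ 2 := by ring
    _ ≤ P.dt ^ 4 * (τ / P.phys.mass) ^ 2 * (N * ‖y‖ ^ 2) * ((T + 1) * (N * ‖x‖ ^ 2)) :=
        mul_le_mul_of_nonneg_left h2 (by positivity)
    _ = P.dt ^ 3 * (τ / P.phys.mass * N) ^ 2 * (‖x‖ ^ 2 * ‖y‖ ^ 2) * ((T + 1) * P.dt) := by ring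
    _ ≤ P.dt ^ 3 * (τ / P.phys.mass * N) ^ 2 * (‖x‖ ^ 2 * ‖y‖ ^ 2) * (τ + 1) :=
        mul_le_mul_of_nonneg_left h3 (by positivity)
    _ = _ := by ring

end Problem

/-! ### Quadratic maps between normed spaces. -/

section Quadratic

variable {E Z : Type*} [NormedAddCommGroup E] [NormedSpace ℝ E]
  [NormedAddCommGroup Z] [NormedSpace ℝ Z]

/-- The quadratic map `x ↦ b + ℓ x + B x x`. -/
def quadMap (b : Z) (ℓ : E →L[ℝ] Z) (B : E →L[ℝ] E →L[ℝ] Z) (x : E) : Z := b + ℓ x + B x x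

/-- The derivative of `quadMap b ℓ B`. -/
def quadDeriv (ℓ : E →L[ℝ] Z) (B : E →L[ℝ] E →L[ℝ] Z) (x h : E) : Z := ℓ h + B x h + B h x

variable (b : Z) (ℓ : E →L[ℝ] Z) (B : E →L[ℝ] E →L[ℝ] Z)

theorem quadMap_add (x h : E) :
    quadMap b ℓ B (x + h) = quadMap b ℓ B x + quadDeriv ℓ B x h + B h h := by
  simp only [quadMap, quadDeriv, map_add, add_apply]
  abel

theorem quadMap_add_smul {h : E} (hB : B h h = 0) (x : E) (t : ℝ) :
    quadMap b ℓ B (x + t • h) = quadMap b ℓ B x + t • quadDeriv ℓ B x h := by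
  rw [quadMap_add]
  simp [quadDeriv, hB]

theorem quadDeriv_sum {ι : Type*} (s : Finset ι) (x : E) (h : ι → E) :
    quadDeriv ℓ B x (∑ i ∈ s, h i) = ∑ i ∈ s, quadDeriv ℓ B x (h i) := by
  simp only [quadDeriv, map_sum, Finset.sum_add_distrib, sum_apply]

theorem norm_quadDeriv_le {r : ℝ} {x : E} (hx : ‖x‖ ≤ r) (h : E) :
    ‖quadDeriv ℓ B x h‖ ≤ (‖ℓ‖ + 2 * ‖B‖ * r) * ‖h‖ := by
  have h1 := ℓ.le_opNorm h
  have h2 := B.le_opNorm₂ x h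
  have h3 := B.le_opNorm₂ h x
  have h4 : ‖B‖ * ‖h‖ * ‖x‖ ≤ ‖B‖ * ‖h‖ * r := mul_le_mul_of_nonneg_left hx (by positivity)
  have h5 := norm_add₃_le (a := ℓ h) (b := B x h) (c := B h x)
  rw [quadDeriv]
  linarith

theorem norm_quadDeriv_sub_le (x u h : E) :
    ‖quadDeriv ℓ B x h - quadDeriv ℓ B u h‖ ≤ 2 * ‖B‖ * ‖x - u‖ * ‖h‖ := by
  have h1 : quadDeriv ℓ B x h - quadDeriv ℓ B u h = B (x - u) h + B h (x - u) := by
    simp only [quadDeriv, map_sub, sub_apply]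
    abel
  have h2 := B.le_opNorm₂ (x - u) h
  have h3 := B.le_opNorm₂ h (x - u)
  have h4 := norm_add_le (B (x - u) h) (B h (x - u))
  rw [h1]
  linarith

theorem norm_quadMap_sub_le {r : ℝ} {x u : E} (hx : ‖x‖ ≤ r) (hu : ‖u‖ ≤ r) :
    ‖quadMap b ℓ B x - quadMap b ℓ B u‖ ≤ (‖ℓ‖ + 2 * ‖B‖ * r) * ‖x - u‖ := by
  have h1 : quadMap b ℓ B x - quadMap b ℓ B u = ℓ (x - u) + B x (x - u) + B (x - u) u := by
    simp only [quadMap, map_sub, sub_apply]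
    abel
  have h2 := ℓ.le_opNorm (x - u)
  have h3 := B.le_opNorm₂ x (x - u)
  have h4 := B.le_opNorm₂ (x - u) u
  have h5 : ‖B‖ * ‖x - u‖ * ‖x‖ ≤ ‖B‖ * ‖x - u‖ * r := mul_le_mul_of_nonneg_left hx (by positivity)
  have h6 : ‖B‖ * ‖x - u‖ * ‖u‖ ≤ ‖B‖ * ‖x - u‖ * r := mul_le_mul_of_nonneg_left hu (by positivity)
  have h7 := norm_add₃_le (a := ℓ (x - u)) (b := B x (x - u)) (c := B (x - u) u)
  rw [h1]
  linarith

end Quadratic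

/-! ### Descent, lower bound and near-minimality for the augmented Lagrangian. -/

section AugmentedLagrangian

variable {E Z : Type*} [NormedAddCommGroup Z] [InnerProductSpace ℝ Z]

/-- The augmented Lagrangian of `f x + φ z` for the constraint `z = q x`. -/
def augLag (f : E → ℝ) (φ : Z → ℝ) (q : E → Z) (ρ : ℝ) (x : E) (z w : Z) : ℝ :=
  f x + φ z + (inner ℝ w (-q x + z) + ρ / 2 * ‖-q x + z‖ ^ 2)

theorem augLag_of_eq (f : E → ℝ) (φ : Z → ℝ) (q : E → Z) (ρ : ℝ) (x : E) (w : Z) :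
    augLag f φ q ρ x (q x) w = f x + φ (q x) := by
  simp [augLag]

variable {f : E → ℝ} {φ : Z → ℝ} {q : E → Z} {ρ : ℝ}

theorem augLag_dual_step (x : E) (z w : Z) :
    augLag f φ q ρ x z (w + ρ • (-q x + z)) = augLag f φ q ρ x z w + ρ * ‖-q x + z‖ ^ 2 := by
  rw [augLag, augLag, inner_add_left, real_inner_smul_left, real_inner_self_eq_norm_sq]
  ring

theorem gradient_eq_neg_of_augLag_le [CompleteSpace Z] (hφ : Differentiable ℝ φ) {x : E} {z w : Z}
    (hmin : ∀ ζ, augLag f φ q ρ x z w ≤ augLag f φ q ρ x ζ w) :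
    gradient φ z = -(w + ρ • (-q x + z)) := by
  have key : ∀ d : Z, 0 ≤ inner ℝ (gradient φ z) d + inner ℝ (w + ρ • (-q x + z)) d := by
    intro d
    refine inner_gradient_add_nonneg (hφ z) (b := ρ / 2 * ‖d‖ ^ 2) fun t _ _ => ?_
    have h1 := hmin (z + t • d)
    rw [augLag, augLag, ← add_assoc (-q x), norm_add_sq_real _ (t • d), inner_add_right _ _ (t • d),
      real_inner_smul_right, real_inner_smul_right, norm_smul, mul_pow, Real.norm_eq_abs,
      sq_abs] at h1
    rw [inner_add_left, real_inner_smul_left]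
    linarith
  have h := key (-(gradient φ z + (w + ρ • (-q x + z))))
  rw [← inner_add_left, inner_neg_right, real_inner_self_eq_norm_sq] at h
  have h0 : ‖gradient φ z + (w + ρ • (-q x + z))‖ = 0 := by
    have := norm_nonneg (gradient φ z + (w + ρ • (-q x + z)))
    nlinarith
  exact eq_neg_of_add_eq_zero_left (norm_eq_zero.1 h0)

theorem augLag_add_le_of_gradient_eq [CompleteSpace Z] {μ : ℝ}
    (hφ : Differentiable ℝ φ) (hc : StrongConvexOn Set.univ μ φ) (hρ : 0 ≤ ρ) {x : E} {z z' w : Z}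
    (hz : gradient φ z' = -(w + ρ • (-q x + z'))) :
    augLag f φ q ρ x z' w + μ / 2 * ‖z - z'‖ ^ 2 ≤ augLag f φ q ρ x z w := by
  have h1 := add_inner_gradient_add_le_of_strongConvexOn hc (hφ z') z
  have h2 : -q x + z = (-q x + z') + (z - z') := by abel
  rw [hz, inner_neg_left, inner_add_left, real_inner_smul_left] at h1
  rw [augLag, augLag, h2, norm_add_sq_real _ (z - z'), inner_add_right _ _ (z - z')]
  have : 0 ≤ ρ / 2 * ‖z - z'‖ ^ 2 := by positivity
  linarith

/-- Because ‖w‖ ≤ L‖z - z₀‖, Young's inequality absorbs the multiplier term into the penalty and μ/8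
of the strong convexity of φ; the bound on ρ makes the penalty large enough, and 3μ/8 = μ/2 - μ/8
remains. -/
theorem le_augLag_of_dual_eq [CompleteSpace Z] {μ L : ℝ} (hμ : 0 < μ) (hρ : 4 * L ^ 2 / μ ≤ ρ)
    (hφ : Differentiable ℝ φ) (hc : StrongConvexOn Set.univ μ φ) (hs : IsSmooth L φ)
    {z₀ : Z} (hz₀ : IsMinOn φ Set.univ z₀) (x : E) {z w : Z} (hw : w = -gradient φ z) :
    f x + φ z₀ + 3 * μ / 8 * ‖z - z₀‖ ^ 2 ≤ augLag f φ q ρ x z w := by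
  have h1 := add_le_of_strongConvexOn_of_isMinOn hc hφ hz₀ z
  have h2 := hs.norm_gradient_le hz₀ z
  have hw' : ‖w‖ ≤ L * ‖z - z₀‖ := by rwa [hw, norm_neg]
  have h3 := (abs_le.1 (abs_real_inner_le_norm w (-q x + z))).1
  have h4 : ‖w‖ * ‖-q x + z‖ ≤ L * ‖z - z₀‖ * ‖-q x + z‖ :=
    mul_le_mul_of_nonneg_right hw' (norm_nonneg _)
  have h5 : 4 * L ^ 2 / μ / 2 * ‖-q x + z‖ ^ 2 ≤ ρ / 2 * ‖-q x + z‖ ^ 2 := by gcongr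
  have h6 : L * ‖z - z₀‖ * ‖-q x + z‖
      ≤ μ / 8 * ‖z - z₀‖ ^ 2 + 4 * L ^ 2 / μ / 2 * ‖-q x + z‖ ^ 2 := by
    have : μ / 8 * ‖z - z₀‖ ^ 2 + 4 * L ^ 2 / μ / 2 * ‖-q x + z‖ ^ 2
        - L * ‖z - z₀‖ * ‖-q x + z‖ = (μ * ‖z - z₀‖ - 4 * L * ‖-q x + z‖) ^ 2 / (8 * μ) := by
      field_simp
      ring
    have : 0 ≤ (μ * ‖z - z₀‖ - 4 * L * ‖-q x + z‖) ^ 2 / (8 * μ) := by positivity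
    linarith
  rw [augLag]
  linarith

variable [NormedAddCommGroup E] [InnerProductSpace ℝ E] [CompleteSpace E]
  {b : Z} {ℓ : E →L[ℝ] Z} {B : E →L[ℝ] E →L[ℝ] Z}

/-- First-order optimality along a direction in which the constraint map is affine. -/
theorem inner_gradient_sub_nonneg_of_augLag_le (hf : Differentiable ℝ f) {u h : E} {z w : Z}
    (hB : B h h = 0)
    (hmin : ∀ t : ℝ, 0 < t → t ≤ 1 → augLag f φ (quadMap b ℓ B) ρ u z w
      ≤ augLag f φ (quadMap b ℓ B) ρ (u + t • h) z w) :
    0 ≤ inner ℝ (gradient f u) h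
      - inner ℝ (w + ρ • (-quadMap b ℓ B u + z)) (quadDeriv ℓ B u h) := by
  rw [sub_eq_add_neg]
  refine inner_gradient_add_nonneg (hf u) (b := ρ / 2 * ‖quadDeriv ℓ B u h‖ ^ 2)
    fun t h0 h1 => ?_
  have h2 := hmin t h0 h1
  have h3 : -(quadMap b ℓ B u + t • quadDeriv ℓ B u h) + z
      = (-quadMap b ℓ B u + z) - t • quadDeriv ℓ B u h := by abel
  rw [augLag, augLag, quadMap_add_smul b ℓ B hB, h3, norm_sub_sq_real, inner_sub_right,
    real_inner_smul_right, real_inner_smul_right, norm_smul, mul_pow, Real.norm_eq_abs,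
    sq_abs] at h2
  rw [inner_add_left, real_inner_smul_left]
  linarith

/-- Along h the constraint map is affine, so the augmented Lagrangian is f plus a convex quadratic
and keeps the strong convexity of f. -/
theorem augLag_add_le_of_inner_nonneg {μ : ℝ} (hf : Differentiable ℝ f)
    (hc : StrongConvexOn Set.univ μ f) (hρ : 0 ≤ ρ) {u h : E} {z w : Z} (hB : B h h = 0)
    (hopt : 0 ≤ inner ℝ (gradient f u) h
      - inner ℝ (w + ρ • (-quadMap b ℓ B u + z)) (quadDeriv ℓ B u h)) :
    augLag f φ (quadMap b ℓ B) ρ u z w + μ / 2 * ‖h‖ ^ 2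
      ≤ augLag f φ (quadMap b ℓ B) ρ (u + h) z w := by
  have h1 := add_inner_gradient_add_le_of_strongConvexOn hc (hf u) (u + h)
  have h3 : -(quadMap b ℓ B u + quadDeriv ℓ B u h) + z
      = (-quadMap b ℓ B u + z) - quadDeriv ℓ B u h := by abel
  rw [add_sub_cancel_left] at h1
  rw [augLag, augLag, quadMap_add, hB, add_zero, h3, norm_sub_sq_real, inner_sub_right]
  rw [inner_add_left, real_inner_smul_left] at hopt
  have : 0 ≤ ρ / 2 * ‖quadDeriv ℓ B u h‖ ^ 2 := by positivity
  linarith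

/-- The optimality condition of a block subproblem, transported from the point `u`, `z` at which
the subproblem is solved to the next iterate `x`, `z'`. -/
theorem neg_le_inner_gradient_sub {L r δ W : ℝ} (hL : IsSmooth L f) (hL0 : 0 ≤ L) (hρ : 0 ≤ ρ)
    {x u h : E} {z z' w : Z} (hx : ‖x‖ ≤ r) (hu : ‖u‖ ≤ r) (hδx : ‖x - u‖ ≤ δ)
    (hδz : ‖z' - z‖ ≤ δ) (hW : ‖w + ρ • (-quadMap b ℓ B x + z')‖ ≤ W)
    (hopt : 0 ≤ inner ℝ (gradient f u) h
      - inner ℝ (w + ρ • (-quadMap b ℓ B u + z)) (quadDeriv ℓ B u h)) :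
    -((L + 2 * ‖B‖ * W + ρ * (1 + (‖ℓ‖ + 2 * ‖B‖ * r)) * (‖ℓ‖ + 2 * ‖B‖ * r)) * δ * ‖h‖)
      ≤ inner ℝ (gradient f x) h
        - inner ℝ (w + ρ • (-quadMap b ℓ B x + z')) (quadDeriv ℓ B x h) := by
  set A := ‖ℓ‖ + 2 * ‖B‖ * r with hA
  set w' := w + ρ • (-quadMap b ℓ B x + z') with hw'
  set p := w + ρ • (-quadMap b ℓ B u + z) with hp
  have hr : 0 ≤ r := (norm_nonneg _).trans hx
  have hA0 : 0 ≤ A := by positivity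
  have hδ0 : 0 ≤ δ := (norm_nonneg _).trans hδx
  have hW0 : 0 ≤ W := (norm_nonneg _).trans hW
  -- Three errors are estimated in turn: the gradient of f, the derivative of the constraint map,
  -- and the multiplier.
  have h1 : -(L * δ * ‖h‖) ≤ inner ℝ (gradient f x - gradient f u) h := by
    refine le_trans (neg_le_neg ?_) (abs_le.1 (abs_real_inner_le_norm _ _)).1
    exact mul_le_mul_of_nonneg_right
      ((hL x u).trans (mul_le_mul_of_nonneg_left hδx hL0)) (norm_nonneg _)
  have h2 : inner ℝ w' (quadDeriv ℓ B x h - quadDeriv ℓ B u h) ≤ 2 * ‖B‖ * W * δ * ‖h‖ := by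
    refine (real_inner_le_norm _ _).trans ?_
    calc ‖w'‖ * ‖quadDeriv ℓ B x h - quadDeriv ℓ B u h‖
        ≤ W * (2 * ‖B‖ * δ * ‖h‖) := by
          refine mul_le_mul hW ((norm_quadDeriv_sub_le ℓ B x u h).trans ?_) (norm_nonneg _) hW0
          gcongr
      _ = _ := by ring
  have h3 : inner ℝ (w' - p) (quadDeriv ℓ B u h) ≤ ρ * (1 + A) * A * δ * ‖h‖ := by
    have h4 : w' - p = ρ • ((z' - z) - (quadMap b ℓ B x - quadMap b ℓ B u)) := by
      rw [hw', hp]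
      module
    have h5 : ‖w' - p‖ ≤ ρ * ((1 + A) * δ) := by
      rw [h4, norm_smul, Real.norm_of_nonneg hρ]
      refine mul_le_mul_of_nonneg_left ((norm_sub_le _ _).trans ?_) hρ
      have h6 := norm_quadMap_sub_le b ℓ B hx hu
      have h7 : A * ‖x - u‖ ≤ A * δ := mul_le_mul_of_nonneg_left hδx hA0
      linarith
    refine (real_inner_le_norm _ _).trans ?_
    calc ‖w' - p‖ * ‖quadDeriv ℓ B u h‖ ≤ ρ * ((1 + A) * δ) * (A * ‖h‖) :=
          mul_le_mul h5 (norm_quadDeriv_le ℓ B hu h) (norm_nonneg _) (by positivity)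
      _ = _ := by ring
  rw [inner_sub_left] at h1 h3
  rw [inner_sub_right] at h2
  linarith

/-- If `x` is stationary up to an error `κ`, and `w = -∇φ(z)` is so small that the quadratic part
of the constraint map does not destroy the strong convexity of `f`, then `(x, z)` minimizes the
augmented Lagrangian up to an error quadratic in `κ` and the residual. -/
theorem augLag_le_add_of_stationary [CompleteSpace Z] {μ μ' κ : ℝ} (hμ : 0 < μ) (hμ' : 0 ≤ μ')
    (hf : Differentiable ℝ f) (hc : StrongConvexOn Set.univ μ f) (hφ : Differentiable ℝ φ)
    (hcφ : StrongConvexOn Set.univ μ' φ) (hρ : 0 ≤ ρ) {x y : E} {z w : Z}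
    (hw : w = -gradient φ z) (hwB : ∀ h, ‖w‖ * ‖B h h‖ ≤ μ / 4 * ‖h‖ ^ 2)
    (hst : -(κ * ‖y - x‖) ≤ inner ℝ (gradient f x) (y - x)
      - inner ℝ w (quadDeriv ℓ B x (y - x))) (ζ : Z) :
    augLag f φ (quadMap b ℓ B) ρ x z w ≤ augLag f φ (quadMap b ℓ B) ρ y ζ w
      + (ρ / 2 * ‖-quadMap b ℓ B x + z‖ ^ 2 + κ ^ 2 / μ) := by
  have h1 := add_inner_gradient_add_le_of_strongConvexOn hc (hf x) y
  have h2 := add_inner_gradient_add_le_of_strongConvexOn hcφ (hφ z) ζ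
  have h3 : gradient φ z = -w := by rw [hw, neg_neg]
  have h4 : quadMap b ℓ B y
      = quadMap b ℓ B x + quadDeriv ℓ B x (y - x) + B (y - x) (y - x) := by
    rw [← quadMap_add, add_sub_cancel]
  have h5 : -quadMap b ℓ B y + ζ = (-quadMap b ℓ B x + z) + (ζ - z)
      - quadDeriv ℓ B x (y - x) - B (y - x) (y - x) := by
    rw [h4]
    abel
  have h6 := real_inner_le_norm w (B (y - x) (y - x))
  have h7 := hwB (y - x)
  -- The μ/2 from the strong convexity of f is split evenly: one μ/4 pays for the curvature of the
  -- constraint (`h7`), the other for the stationarity error.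
  have h8 : κ * ‖y - x‖ ≤ μ / 4 * ‖y - x‖ ^ 2 + κ ^ 2 / μ := by
    have : μ / 4 * ‖y - x‖ ^ 2 + κ ^ 2 / μ - κ * ‖y - x‖
        = (μ * ‖y - x‖ - 2 * κ) ^ 2 / (4 * μ) := by
      field_simp
      ring
    have : 0 ≤ (μ * ‖y - x‖ - 2 * κ) ^ 2 / (4 * μ) := by positivity
    linarith
  have h9 : 0 ≤ ρ / 2 * ‖-quadMap b ℓ B y + ζ‖ ^ 2 := by positivity
  have h10 : 0 ≤ μ' / 2 * ‖ζ - z‖ ^ 2 := by positivity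
  have h11 : inner ℝ w (-quadMap b ℓ B y + ζ) = inner ℝ w (-quadMap b ℓ B x + z)
      + inner ℝ w (ζ - z) - inner ℝ w (quadDeriv ℓ B x (y - x))
      - inner ℝ w (B (y - x) (y - x)) := by
    rw [h5, inner_sub_right, inner_sub_right, inner_add_right]
  rw [h3, inner_neg_left] at h2
  simp only [augLag]
  linarith

end AugmentedLagrangian

/-! ### From decrease and gap to convergence. -/

section Limit

variable {E Z : Type*} [NormedAddCommGroup Z] [InnerProductSpace ℝ Z]

theorem augLag_eq_add_inner (f : E → ℝ) (φ : Z → ℝ) (q : E → Z) (ρ : ℝ) (x : E) (z w w' : Z) :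
    augLag f φ q ρ x z w = augLag f φ q ρ x z w' + inner ℝ (w - w') (-q x + z) := by
  rw [augLag, augLag, inner_sub_left]
  ring

theorem continuous_augLag [TopologicalSpace E] {f : E → ℝ} {φ : Z → ℝ} {q : E → Z} (hf : Continuous f)
    (hφ : Continuous φ) (hq : Continuous q) (ρ : ℝ) :
    Continuous fun p : E × Z × Z => augLag f φ q ρ p.1 p.2.1 p.2.2 := by
  unfold augLag
  fun_prop

/-- A dual sequence `w k = -∇φ(z k)` with primal residuals `(w (k + 1) - w k) / ρ`, along which the
augmented Lagrangian decreases sufficiently and is nearly minimal, converges linearly to a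
minimizer of `f x + φ (q x)` over `S`. -/
theorem exists_linear_convergence [NormedAddCommGroup E] [CompleteSpace E] [CompleteSpace Z]
    {f : E → ℝ} {φ : Z → ℝ} {q : E → Z} {ρ L a C W c₀ : ℝ}
    (hf : Continuous f) (hφ : Continuous φ) (hq : Continuous q) (hL : IsSmooth L φ)
    (hρ : 0 < ρ) (ha : 0 < a) (hC : 0 ≤ C) {S : Set E} (hS : IsClosed S)
    {x : ℕ → E} {z w : ℕ → Z} (hxS : ∀ k, x k ∈ S) (hw : ∀ k, w k = -gradient φ (z k))
    (hstep : ∀ k, w (k + 1) = w k + ρ • (-q (x (k + 1)) + z (k + 1)))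
    (hW : ∀ k, ‖w k‖ ≤ W) (hlow : ∀ k, c₀ ≤ augLag f φ q ρ (x k) (z k) (w k))
    (hdec : ∀ k, augLag f φ q ρ (x (k + 1)) (z (k + 1)) (w (k + 1))
      + a * (‖x (k + 1) - x k‖ ^ 2 + ‖z (k + 1) - z k‖ ^ 2) ≤ augLag f φ q ρ (x k) (z k) (w k))
    (hgap : ∀ k, ∀ y ∈ S, ∀ ζ, augLag f φ q ρ (x (k + 1)) (z (k + 1)) (w (k + 1))
      ≤ augLag f φ q ρ y ζ (w (k + 1))
        + C * (‖x (k + 1) - x k‖ ^ 2 + ‖z (k + 1) - z k‖ ^ 2)) :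
    ∃ θ K : ℝ, 0 < θ ∧ θ < 1 ∧ 0 ≤ K ∧
      (∀ k, ‖x (k + 1) - x k‖ ^ 2 + ‖z (k + 1) - z k‖ ^ 2 ≤ K * θ ^ k) ∧
      ∃ xs zs ws, Tendsto x atTop (𝓝 xs) ∧ Tendsto z atTop (𝓝 zs) ∧ Tendsto w atTop (𝓝 ws) ∧
        xs ∈ S ∧ zs = q xs ∧ ∀ y ∈ S, f xs + φ zs ≤ f y + φ (q y) := by
  set l : ℕ → ℝ := fun k => augLag f φ q ρ (x k) (z k) (w k) with hl
  set D : ℕ → ℝ := fun k => ‖x (k + 1) - x k‖ ^ 2 + ‖z (k + 1) - z k‖ ^ 2 with hD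
  have hD0 : ∀ k, 0 ≤ D k := fun k => by positivity
  have hanti : Antitone l := antitone_nat_of_succ_le fun k => by
    have h1 := hdec k
    have h2 := mul_nonneg ha.le (hD0 k)
    change l (k + 1) + a * D k ≤ l k at h1
    linarith
  have hlim : Tendsto l atTop (𝓝 (⨅ k, l k)) :=
    tendsto_atTop_ciInf hanti ⟨c₀, by rintro _ ⟨k, rfl⟩; exact hlow k⟩
  have hDlim : Tendsto D atTop (𝓝 0) := by
    have h1 : Tendsto (fun k => (l k - l (k + 1)) / a) atTop (𝓝 0) := by
      simpa using (hlim.sub (hlim.comp (tendsto_add_atTop_nat 1))).div_const a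
    refine squeeze_zero hD0 (fun k => ?_) h1
    rw [le_div_iff₀ ha]
    have h2 := hdec k
    change l (k + 1) + a * D k ≤ l k at h2
    linarith
  have hzlim : Tendsto (fun k => ‖z (k + 1) - z k‖) atTop (𝓝 0) := by
    have h1 : Tendsto (fun k => Real.sqrt (D k)) atTop (𝓝 0) := by
      have h2 := (Real.continuous_sqrt.tendsto 0).comp hDlim
      rwa [Real.sqrt_zero] at h2
    refine squeeze_zero (fun _ => norm_nonneg _) (fun k => ?_) h1
    refine Real.le_sqrt_of_sq_le ?_
    have : 0 ≤ ‖x (k + 1) - x k‖ ^ 2 := by positivity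
    change _ ≤ ‖x (k + 1) - x k‖ ^ 2 + ‖z (k + 1) - z k‖ ^ 2
    linarith
  have hres : Tendsto (fun k => -q (x (k + 1)) + z (k + 1)) atTop (𝓝 0) := by
    have h1 : ∀ k, ‖-q (x (k + 1)) + z (k + 1)‖ ≤ ρ⁻¹ * L * ‖z (k + 1) - z k‖ := by
      intro k
      have h2 : -q (x (k + 1)) + z (k + 1) = ρ⁻¹ • (w (k + 1) - w k) := by
        rw [hstep k, add_sub_cancel_left, smul_smul, inv_mul_cancel₀ hρ.ne', one_smul]
      rw [h2, norm_smul, Real.norm_of_nonneg (by positivity), mul_assoc]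
      refine mul_le_mul_of_nonneg_left ?_ (by positivity)
      rw [hw, hw, neg_sub_neg, norm_sub_rev (z (k + 1))]
      exact hL _ _
    refine squeeze_zero_norm h1 ?_
    simpa using hzlim.const_mul (ρ⁻¹ * L)
  -- No limit point is known yet, so compare with the iterates of index j + 1. Exchanging the
  -- multiplier w_{k+1} for w_{j+1} costs an inner product with the residual, which vanishes as j →
  -- ∞.
  have hgap' : ∀ k, l (k + 1) ≤ (⨅ k, l k) + C * D k := by
    intro k
    have h1 : Tendsto (fun j => l (j + 1) + 2 * W * ‖-q (x (j + 1)) + z (j + 1)‖ + C * D k) atTop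
        (𝓝 ((⨅ k, l k) + 2 * W * 0 + C * D k)) := by
      refine ((hlim.comp (tendsto_add_atTop_nat 1)).add (Tendsto.const_mul _ ?_)).add_const _
      simpa using hres.norm
    rw [mul_zero, add_zero] at h1
    refine ge_of_tendsto' h1 fun j => (hgap k _ (hxS (j + 1)) (z (j + 1))).trans ?_
    rw [augLag_eq_add_inner f φ q ρ _ _ _ (w (j + 1))]
    have h2 := real_inner_le_norm (w (k + 1) - w (j + 1)) (-q (x (j + 1)) + z (j + 1))
    have h3 : ‖w (k + 1) - w (j + 1)‖ ≤ 2 * W := by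
      linarith [norm_sub_le (w (k + 1)) (w (j + 1)), hW (k + 1), hW (j + 1)]
    have h4 := mul_le_mul_of_nonneg_right h3 (norm_nonneg (-q (x (j + 1)) + z (j + 1)))
    change l (j + 1) + _ + C * D k ≤ _
    linarith
  obtain ⟨θ, K, hθ, hθ1, hK, hDK⟩ := exists_geometric_bound ha hC hD0 hdec hlim hgap'
  obtain ⟨xs, hxs⟩ := exists_tendsto_of_sq_norm_sub_le (u := x) hθ hθ1 hK fun k =>
    le_trans (le_add_of_nonneg_right (by positivity)) (hDK k)
  obtain ⟨zs, hzs⟩ := exists_tendsto_of_sq_norm_sub_le (u := z) hθ hθ1 hK fun k =>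
    le_trans (le_add_of_nonneg_left (by positivity)) (hDK k)
  have hws : Tendsto w atTop (𝓝 (-gradient φ zs)) := by
    have h1 := ((hL.continuous_gradient.tendsto zs).comp hzs).neg
    exact h1.congr fun k => (hw k).symm
  have hqs : zs = q xs := by
    have h1 : Tendsto (fun k => -q (x k) + z k) atTop (𝓝 (-q xs + zs)) :=
      ((hq.tendsto xs).comp hxs).neg.add hzs
    have h2 := tendsto_nhds_unique (h1.comp (tendsto_add_atTop_nat 1)) hres
    exact (neg_add_eq_zero.1 h2).symm
  refine ⟨θ, K, hθ, hθ1, hK, hDK, xs, zs, _, hxs, hzs, hws,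
    hS.mem_of_tendsto hxs (Eventually.of_forall hxS), hqs, fun y hy => ?_⟩
  have hls : Tendsto l atTop (𝓝 (f xs + φ zs)) := by
    have h1 := ((continuous_augLag hf hφ hq ρ).tendsto (xs, zs, -gradient φ zs)).comp
      (hxs.prodMk_nhds (hzs.prodMk_nhds hws))
    have h2 : augLag f φ q ρ xs zs (-gradient φ zs) = f xs + φ zs := by rw [hqs, augLag_of_eq]
    rw [← h2]
    exact h1
  have h1 : Tendsto (fun k => f y + φ (q y) + C * D k) atTop (𝓝 (f y + φ (q y) + C * 0)) :=
    (hDlim.const_mul C).const_add _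
  rw [mul_zero, add_zero] at h1
  refine le_of_tendsto_of_tendsto' (hls.comp (tendsto_add_atTop_nat 1)) h1 fun k => ?_
  have h2 := hgap k y hy (q y)
  rwa [augLag_of_eq] at h2

end Limit

/-! ### Intermediate points of a sweep over the blocks. -/

section Splice

/-- The point whose first `n` blocks are those of `x'`, and whose other blocks are those of `x`. -/
def mixBlocks (x' x : Forces N T) (n : ℕ) : Forces N T :=
  WithLp.toLp 2 fun j => if (j : ℕ) < n then x' j else x j

theorem mixBlocks_apply (x' x : Forces N T) (n : ℕ) (j : Fin (T + 1)) :
    mixBlocks x' x n j = if (j : ℕ) < n then x' j else x j := rfl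

theorem mixBlocks_zero (x' x : Forces N T) : mixBlocks x' x 0 = x := by
  ext j : 1
  simp [mixBlocks_apply]

theorem mixBlocks_last (x' x : Forces N T) : mixBlocks x' x (T + 1) = x' := by
  ext j : 1
  rw [mixBlocks_apply, if_pos j.2]

theorem splice_apply (x' x : Forces N T) (i j : Fin (T + 1)) (y : Block N) :
    splice x' x i y j = if j < i then x' j else if j = i then y else x j := rfl

/-- Puts the competitors of subproblem i on a single-block displacement from its solution, where the
bilinear part of the constraint is inactive. -/
theorem splice_eq_mixBlocks_succ (x' x : Forces N T) (i : Fin (T + 1)) (y : Block N) :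
    splice x' x i y = mixBlocks x' x (i + 1) + PiLp.single 2 i (y - x' i) := by
  ext j : 1
  rw [PiLp.add_apply, mixBlocks_apply, splice_apply]
  rcases lt_trichotomy j i with h | rfl | h
  · have h1 : (j : ℕ) < i + 1 := by have := Fin.lt_def.1 h; omega
    rw [if_pos h, if_pos h1, PiLp.single_eq_of_ne 2 h.ne, add_zero]
  · simp
  · have h1 : ¬ (j : ℕ) < i + 1 := by have := Fin.lt_def.1 h; omega
    rw [if_neg h.not_gt, if_neg h.ne', if_neg h1, PiLp.single_eq_of_ne 2 h.ne', add_zero]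

theorem splice_self (x' x : Forces N T) (i : Fin (T + 1)) :
    splice x' x i (x' i) = mixBlocks x' x (i + 1) := by
  rw [splice_eq_mixBlocks_succ, sub_self]
  ext j : 1
  simp

theorem splice_old (x' x : Forces N T) (i : Fin (T + 1)) :
    splice x' x i (x i) = mixBlocks x' x i := by
  ext j : 1
  rw [mixBlocks_apply, splice_apply]
  rcases lt_trichotomy j i with h | rfl | h
  · rw [if_pos h, if_pos (Fin.lt_def.1 h)]
  · simp
  · rw [if_neg h.not_gt, if_neg h.ne', if_neg (Fin.lt_def.1 h).not_gt]

theorem norm_sub_mixBlocks_le (x' x : Forces N T) (n : ℕ) :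
    ‖x' - mixBlocks x' x n‖ ≤ ‖x' - x‖ := by
  refine abs_le_of_sq_le_sq' ?_ (norm_nonneg _) |>.2
  rw [PiLp.norm_sq_eq_of_L2, PiLp.norm_sq_eq_of_L2]
  refine Finset.sum_le_sum fun j _ => ?_
  rw [PiLp.sub_apply, PiLp.sub_apply, mixBlocks_apply]
  split_ifs
  · rw [sub_self, norm_zero, zero_pow two_ne_zero]
    positivity
  · exact le_rfl

theorem sum_single_sub (y x : Forces N T) :
    ∑ i, (PiLp.single 2 i (y i - x i) : Forces N T) = y - x := by
  ext j : 1
  rw [WithLp.ofLp_sum, Finset.sum_apply, Finset.sum_eq_single j]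
  · rw [PiLp.single_eq_same, PiLp.sub_apply]
  · intro i _ hij
    exact PiLp.single_eq_of_ne 2 hij.symm _
  · simp

theorem single_smul_block (i : Fin (T + 1)) (t : ℝ) (v : Block N) :
    (PiLp.single 2 i (t • v) : Forces N T) = t • PiLp.single 2 i v := by
  rw [← PiLp.toLp_single, Pi.single_smul, WithLp.toLp_smul, PiLp.toLp_single]

theorem norm_single_block (i : Fin (T + 1)) (v : Block N) :
    ‖(PiLp.single 2 i v : Forces N T)‖ = ‖v‖ := PiLp.norm_single _ _ _ _

end Splice

/-! ### The extended-valued Lagrangian and its smooth part. -/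

namespace Problem

/-- The points all of whose blocks satisfy the constraints `x_i ∈ X_i`. -/
def admissible (P : Problem N T) : Set (Forces N T) := {x | ∀ i, x i ∈ P.X i}

/-- The momentum increments as a quadratic map. -/
def quad (P : Problem N T) : Forces N T → Momenta T :=
  quadMap (consMomenta P.phys.kInit 0) P.momLin P.momBil

/-- The augmented Lagrangian without the indicator functions. -/
def smoothLag (P : Problem N T) (ρ : ℝ) (x : Forces N T) (z w : Momenta T) : ℝ :=
  augLag P.f P.φ P.quad ρ x z w

theorem residual_eq (P : Problem N T) (x : Forces N T) (z : Momenta T) :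
    P.residual x z = -P.quad x + z := by
  rw [residual, momentum_eq]
  rfl

theorem continuous_quad (P : Problem N T) : Continuous P.quad := by
  unfold quad quadMap
  fun_prop

theorem isClosed_admissible (P : Problem N T) (hX : ∀ i, IsClosed (P.X i)) :
    IsClosed P.admissible := by
  have : P.admissible = ⋂ i, (fun x : Forces N T => x i) ⁻¹' P.X i := by
    ext x
    simp [admissible]
  rw [this]
  exact isClosed_iInter fun i => (hX i).preimage (PiLp.continuous_apply 2 _ i)

theorem objective_of_mem (P : Problem N T) {x : Forces N T} (hx : x ∈ P.admissible)
    (z : Momenta T) : P.objective x z = ((P.f x + P.φ z : ℝ) : EReal) := by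
  have : ∑ i, indicatorFn (P.X i) (x i) = 0 :=
    Finset.sum_eq_zero fun i _ => if_pos (hx i)
  rw [objective, this, add_zero]

theorem objective_of_notMem (P : Problem N T) {x : Forces N T} (hx : x ∉ P.admissible)
    (z : Momenta T) : P.objective x z = ⊤ := by
  have hnn : ∀ i, 0 ≤ indicatorFn (P.X i) (x i) := fun i => by
    unfold indicatorFn
    split_ifs
    exacts [le_rfl, le_top]
  obtain ⟨i, hi⟩ : ∃ i, x i ∉ P.X i := by
    by_contra! h
    exact hx h
  have : ∑ i, indicatorFn (P.X i) (x i) = ⊤ := by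
    refine top_unique ?_
    calc (⊤ : EReal) = indicatorFn (P.X i) (x i) := (if_neg hi).symm
      _ ≤ _ := Finset.single_le_sum (f := fun i => indicatorFn (P.X i) (x i))
        (fun i _ => hnn i) (Finset.mem_univ i)
  rw [objective, this, EReal.coe_add_top]

theorem lagrangian_of_mem (P : Problem N T) {x : Forces N T} (hx : x ∈ P.admissible) (ρ : ℝ)
    (z w : Momenta T) : P.lagrangian ρ x z w = (P.smoothLag ρ x z w : EReal) := by
  rw [lagrangian, P.objective_of_mem hx, residual_eq, smoothLag, augLag, ← EReal.coe_add]

theorem lagrangian_of_notMem (P : Problem N T) {x : Forces N T} (hx : x ∉ P.admissible) (ρ : ℝ)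
    (z w : Momenta T) : P.lagrangian ρ x z w = ⊤ := by
  rw [lagrangian, P.objective_of_notMem hx, EReal.top_add_coe]

theorem mem_of_lagrangian_le (P : Problem N T) {x y : Forces N T} {ρ : ℝ} {z w z' w' : Momenta T}
    (hy : y ∈ P.admissible) (h : P.lagrangian ρ x z w ≤ P.lagrangian ρ y z' w') :
    x ∈ P.admissible := by
  by_contra hx
  rw [P.lagrangian_of_notMem hx, P.lagrangian_of_mem hy, top_le_iff] at h
  exact EReal.coe_ne_top _ h

end Problem

/-! ### One sweep of block minimizations. -/

section Steps

variable {P : Problem N T} {ρ : ℝ} {x x' : Forces N T} {z w : Momenta T}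

/-- Strong induction on the block: once the earlier blocks are admissible, keeping the old block has
finite value, so the minimizer has finite value too. -/
theorem admissible_of_x_step (hx : x ∈ P.admissible)
    (hstep : ∀ i, IsMinOn (fun y => P.lagrangian ρ (splice x' x i y) z w) Set.univ (x' i)) :
    x' ∈ P.admissible := by
  intro i
  induction i using WellFoundedLT.induction with
  | _ i ih =>
    have hmix : mixBlocks x' x i ∈ P.admissible := fun j => by
      rw [mixBlocks_apply]
      split_ifs with hj
      exacts [ih j (Fin.lt_def.2 hj), hx j]
    have h := isMinOn_univ_iff.1 (hstep i) (x i)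
    rw [splice_old] at h
    have h1 := P.mem_of_lagrangian_le hmix h i
    rwa [splice_apply, if_neg (lt_irrefl i), if_pos rfl] at h1

theorem mixBlocks_mem (hx : x ∈ P.admissible) (hx' : x' ∈ P.admissible) (n : ℕ) :
    mixBlocks x' x n ∈ P.admissible := by
  intro j
  rw [mixBlocks_apply]
  split_ifs
  exacts [hx' j, hx j]

theorem block_optimality (hf : Differentiable ℝ P.f) (hX : ∀ i, Convex ℝ (P.X i))
    (hx : x ∈ P.admissible) (hx' : x' ∈ P.admissible) {i : Fin (T + 1)}
    (hstep : IsMinOn (fun y => P.lagrangian ρ (splice x' x i y) z w) Set.univ (x' i))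
    {y : Block N} (hy : y ∈ P.X i) :
    0 ≤ inner ℝ (gradient P.f (mixBlocks x' x (i + 1))) (PiLp.single 2 i (y - x' i))
      - inner ℝ (w + ρ • (-P.quad (mixBlocks x' x (i + 1)) + z))
        (quadDeriv P.momLin P.momBil (mixBlocks x' x (i + 1)) (PiLp.single 2 i (y - x' i))) := by
  refine inner_gradient_sub_nonneg_of_augLag_le (φ := P.φ) hf
    (P.momBil_single_single i (y - x' i)) fun t ht0 ht1 => ?_
  have h1 : mixBlocks x' x (i + 1) + t • PiLp.single 2 i (y - x' i)
      = splice x' x i (x' i + t • (y - x' i)) := by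
    rw [splice_eq_mixBlocks_succ, add_sub_cancel_left, single_smul_block]
  have hu := mixBlocks_mem hx hx' (i + 1)
  have hv : splice x' x i (x' i + t • (y - x' i)) ∈ P.admissible := by
    intro j
    rw [splice_apply]
    split_ifs with h2 h3
    · exact hx' j
    · subst h3
      exact (hX j).add_smul_sub_mem (hx' j) hy ⟨ht0.le, ht1⟩
    · exact hx j
  have h2 := isMinOn_univ_iff.1 hstep (x' i + t • (y - x' i))
  rw [splice_self, P.lagrangian_of_mem hu, P.lagrangian_of_mem hv, EReal.coe_le_coe_iff, ← h1]
    at h2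
  exact h2

/-- Taking the old block as competitor gives a gain of μ/2 times its squared displacement; the
values at the intermediate points telescope. -/
theorem smoothLag_add_le_of_x_step {μ : ℝ} (hf : Differentiable ℝ P.f)
    (hc : StrongConvexOn Set.univ μ P.f) (hρ : 0 ≤ ρ) (hX : ∀ i, Convex ℝ (P.X i))
    (hx : x ∈ P.admissible) (hx' : x' ∈ P.admissible)
    (hstep : ∀ i, IsMinOn (fun y => P.lagrangian ρ (splice x' x i y) z w) Set.univ (x' i)) :
    P.smoothLag ρ x' z w + μ / 2 * ‖x' - x‖ ^ 2 ≤ P.smoothLag ρ x z w := by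
  have h1 : ∀ i : Fin (T + 1), μ / 2 * ‖(x' - x) i‖ ^ 2
      ≤ P.smoothLag ρ (mixBlocks x' x i) z w - P.smoothLag ρ (mixBlocks x' x (i + 1)) z w := by
    intro i
    have h2 := augLag_add_le_of_inner_nonneg (φ := P.φ) hf hc hρ
      (P.momBil_single_single i (x i - x' i)) (block_optimality hf hX hx hx' (hstep i) (hx i))
    have h3 : mixBlocks x' x i
        = mixBlocks x' x (i + 1) + PiLp.single 2 i (x i - x' i) := by
      rw [← splice_eq_mixBlocks_succ, splice_old]
    rw [← h3, norm_single_block, norm_sub_rev] at h2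
    rw [le_sub_iff_add_le']
    exact h2
  have h4 := Finset.sum_le_sum fun i (_ : i ∈ Finset.univ) => h1 i
  rw [Fin.sum_univ_eq_sum_range (fun n => P.smoothLag ρ (mixBlocks x' x n) z w
    - P.smoothLag ρ (mixBlocks x' x (n + 1)) z w), Finset.sum_range_sub', mixBlocks_zero,
    mixBlocks_last, ← Finset.mul_sum, ← PiLp.norm_sq_eq_of_L2] at h4
  linarith

/-- Each block condition holds at its own intermediate point. Transporting all of them to x' and
summing over the T + 1 blocks gives one variational inequality in the full direction y - x'. -/
theorem stationary_of_x_step {L r W δ : ℝ} (hf : Differentiable ℝ P.f) (hL : IsSmooth L P.f)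
    (hL0 : 0 ≤ L) (hρ : 0 ≤ ρ) (hX : ∀ i, Convex ℝ (P.X i))
    (hx : x ∈ P.admissible) (hx' : x' ∈ P.admissible) {z' : Momenta T}
    (hstep : ∀ i, IsMinOn (fun y => P.lagrangian ρ (splice x' x i y) z w) Set.univ (x' i))
    (hr : ‖x‖ ≤ r) (hr' : ‖x'‖ ≤ r) (hδx : ‖x' - x‖ ≤ δ) (hδz : ‖z' - z‖ ≤ δ)
    (hW : ‖w + ρ • (-P.quad x' + z')‖ ≤ W) {y : Forces N T} (hy : y ∈ P.admissible) :
    -((T + 1) * (L + 2 * ‖P.momBil‖ * W + ρ * (1 + (‖P.momLin‖ + 2 * ‖P.momBil‖ * (3 * r)))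
      * (‖P.momLin‖ + 2 * ‖P.momBil‖ * (3 * r))) * δ * ‖y - x'‖)
      ≤ inner ℝ (gradient P.f x') (y - x')
        - inner ℝ (w + ρ • (-P.quad x' + z')) (quadDeriv P.momLin P.momBil x' (y - x')) := by
  set κ := L + 2 * ‖P.momBil‖ * W + ρ * (1 + (‖P.momLin‖ + 2 * ‖P.momBil‖ * (3 * r)))
      * (‖P.momLin‖ + 2 * ‖P.momBil‖ * (3 * r)) with hκ
  have hr0 : 0 ≤ r := (norm_nonneg _).trans hr
  have hW0 : 0 ≤ W := (norm_nonneg _).trans hW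
  have hδ0 : 0 ≤ δ := (norm_nonneg _).trans hδx
  have hκ0 : 0 ≤ κ := by positivity
  have h1 : ∀ i : Fin (T + 1), -(κ * δ * ‖y - x'‖)
      ≤ inner ℝ (gradient P.f x') (PiLp.single 2 i (y i - x' i))
        - inner ℝ (w + ρ • (-P.quad x' + z'))
          (quadDeriv P.momLin P.momBil x' (PiLp.single 2 i (y i - x' i))) := by
    intro i
    -- The intermediate point is within ‖x' - x‖ ≤ 2r of x'.
    have hu : ‖mixBlocks x' x (i + 1)‖ ≤ 3 * r := by
      have h2 := norm_sub_mixBlocks_le x' x (i + 1)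
      have h3 := norm_sub_le x' x
      have h4 := norm_sub_le x' (x' - mixBlocks x' x (i + 1))
      rw [sub_sub_cancel] at h4
      linarith
    have h5 := neg_le_inner_gradient_sub (z := z) (z' := z') (w := w) hL hL0 hρ
      (hr'.trans (by linarith : r ≤ 3 * r)) hu
      ((norm_sub_mixBlocks_le x' x (i + 1)).trans hδx) hδz hW
      (block_optimality hf hX hx hx' (hstep i) (hy i))
    refine le_trans (neg_le_neg ?_) h5
    refine mul_le_mul_of_nonneg_left ?_ (mul_nonneg hκ0 hδ0)
    rw [norm_single_block]
    exact PiLp.norm_apply_le (y - x') i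
  have h6 := Finset.sum_le_sum fun i (_ : i ∈ Finset.univ) => h1 i
  rw [Finset.sum_sub_distrib, ← inner_sum, ← inner_sum, ← quadDeriv_sum, sum_single_sub,
    Finset.sum_const, Finset.card_univ, Fintype.card_fin, nsmul_eq_mul] at h6
  push_cast at h6
  linarith

end Steps

/-- The regularity assumptions on the costs and on the constraint sets. -/
structure Problem.IsRegular (P : Problem N T) (μf Lf μφ Lφ : ℝ) : Prop where
  μf_pos : 0 < μf
  Lf_pos : 0 < Lf
  μφ_pos : 0 < μφ
  Lφ_pos : 0 < Lφ
  isClosed : ∀ i, IsClosed (P.X i)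
  convex : ∀ i, Convex ℝ (P.X i)
  differentiable_f : Differentiable ℝ P.f
  strongConvex_f : StrongConvexOn Set.univ μf P.f
  isSmooth_f : IsSmooth Lf P.f
  differentiable_φ : Differentiable ℝ P.φ
  strongConvex_φ : StrongConvexOn Set.univ μφ P.φ
  isSmooth_φ : IsSmooth Lφ P.φ

/-! ### Closedness and convexity of polyhedral sets. -/

section Polyhedral

variable {E : Type*} [NormedAddCommGroup E] [InnerProductSpace ℝ E] {S : Set E}

theorem IsPolyhedral.isClosed (hS : IsPolyhedral S) : IsClosed S := by
  obtain ⟨n, a, b, rfl⟩ := hS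
  simp only [Set.ofPred_forall]
  exact isClosed_iInter fun l => isClosed_le (by fun_prop) continuous_const

theorem IsPolyhedral.convex (hS : IsPolyhedral S) : Convex ℝ S := by
  obtain ⟨n, a, b, rfl⟩ := hS
  simp only [Set.ofPred_forall]
  exact convex_iInter fun l => convex_halfSpace_le (innerₗ E (a l)).isLinear (b l)

end Polyhedral

theorem Problem.exists_isLeast_ball (P : Problem N T) (hX : ∀ i, IsClosed (P.X i))
    (hf : Continuous P.f) (hφ : Continuous P.φ) {x : Forces N T} (hx : x ∈ P.admissible)
    (z w : Momenta T) (ρ r : ℝ) :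
    ∃ p : Forces N T × Momenta T, p.1 ∈ P.admissible ∧ p ∈ ball x z r ∧
      IsLeast ((fun p => P.lagrangian ρ p.1 p.2 w) '' ball x z r)
        (P.smoothLag ρ p.1 p.2 w : EReal) := by
  have hclosed : IsClosed (ball x z r ∩ {p | p.1 ∈ P.admissible}) := by
    refine IsClosed.inter ?_ ((P.isClosed_admissible hX).preimage continuous_fst)
    exact isClosed_le (by fun_prop) continuous_const
  have hbdd : ball x z r ⊆ Metric.closedBall (x, z) |r| := by
    intro p hp
    have hp' : ‖p.1 - x‖ ^ 2 + ‖p.2 - z‖ ^ 2 ≤ r ^ 2 := hp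
    rw [Metric.mem_closedBall, Prod.dist_eq, dist_eq_norm, dist_eq_norm]
    refine max_le (abs_norm (p.1 - x) ▸ sq_le_sq.1 ?_) (abs_norm (p.2 - z) ▸ sq_le_sq.1 ?_)
    · exact le_trans (le_add_of_nonneg_right (by positivity)) hp'
    · exact le_trans (le_add_of_nonneg_left (by positivity)) hp'
  have hcomp : IsCompact (ball x z r ∩ {p | p.1 ∈ P.admissible}) :=
    Metric.isCompact_of_isClosed_isBounded hclosed
      (Metric.isBounded_closedBall.subset (Set.inter_subset_left.trans hbdd))
  have hcont : Continuous fun p : Forces N T × Momenta T => P.smoothLag ρ p.1 p.2 w :=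
    (continuous_augLag hf hφ P.continuous_quad ρ).comp
      (continuous_fst.prodMk (continuous_snd.prodMk continuous_const))
  obtain ⟨p, hp, hmin⟩ := hcomp.exists_isMinOn
    ⟨(x, z), by simpa [ball] using sq_nonneg r, hx⟩
    hcont.continuousOn
  refine ⟨p, hp.2, hp.1, ⟨p, hp.1, P.lagrangian_of_mem hp.2 ρ _ _⟩, ?_⟩
  rintro _ ⟨p', hp', rfl⟩
  by_cases h : p'.1 ∈ P.admissible
  · simp only [P.lagrangian_of_mem h]
    exact EReal.coe_le_coe_iff.2 (hmin ⟨hp', h⟩)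
  · simp only [P.lagrangian_of_notMem h]
    exact le_top

/-! ### Estimates along the ADMM iterates. -/

section Iterates

variable {P : Problem N T} {μf Lf μφ Lφ ρ : ℝ} {x : ℕ → Forces N T} {z w : ℕ → Momenta T}

theorem IsADMM.mem_admissible (hA : IsADMM P ρ x z w) (hx : x 0 ∈ P.admissible) (k : ℕ) :
    x k ∈ P.admissible := by
  induction k with
  | zero => exact hx
  | succ k ih => exact admissible_of_x_step ih (hA.x_step k)

theorem IsADMM.dual_step (hA : IsADMM P ρ x z w) (k : ℕ) :
    w (k + 1) = w k + ρ • (-P.quad (x (k + 1)) + z (k + 1)) := by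
  rw [hA.w_step, P.residual_eq]

theorem IsADMM.gradient_eq (hA : IsADMM P ρ x z w) (hP : P.IsRegular μf Lf μφ Lφ)
    (hx : x 0 ∈ P.admissible) (k : ℕ) :
    gradient P.φ (z (k + 1)) = -(w k + ρ • (-P.quad (x (k + 1)) + z (k + 1))) := by
  refine gradient_eq_neg_of_augLag_le (f := P.f) hP.differentiable_φ fun ζ => ?_
  have hk := hA.mem_admissible hx (k + 1)
  have h := isMinOn_univ_iff.1 (hA.z_step k) ζ
  rw [P.lagrangian_of_mem hk, P.lagrangian_of_mem hk, EReal.coe_le_coe_iff] at h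
  exact h

theorem IsADMM.dual_eq (hA : IsADMM P ρ x z w) (hP : P.IsRegular μf Lf μφ Lφ)
    (hx : x 0 ∈ P.admissible) (hw : w 0 = -gradient P.φ (z 0)) (k : ℕ) :
    w k = -gradient P.φ (z k) := by
  cases k with
  | zero => exact hw
  | succ k => rw [hA.gradient_eq hP hx k, neg_neg, hA.dual_step k]

theorem Problem.IsRegular.ρ_pos (hP : P.IsRegular μf Lf μφ Lφ) (hρ : 4 * Lφ ^ 2 / μφ ≤ ρ) :
    0 < ρ := by
  have h1 := hP.Lφ_pos
  have h2 := hP.μφ_pos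
  exact lt_of_lt_of_le (by positivity) hρ

/-- The dual increment is ρ times the residual and also minus the increment of ∇φ, which is
L_φ-Lipschitz; then use ρ ≥ 4L_φ²/μ_φ. -/
theorem IsADMM.sq_residual_le (hA : IsADMM P ρ x z w) (hP : P.IsRegular μf Lf μφ Lφ)
    (hρ : 4 * Lφ ^ 2 / μφ ≤ ρ) (hx : x 0 ∈ P.admissible) (hw : w 0 = -gradient P.φ (z 0))
    (k : ℕ) :
    ρ * ‖-P.quad (x (k + 1)) + z (k + 1)‖ ^ 2 ≤ μφ / 4 * ‖z (k + 1) - z k‖ ^ 2 := by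
  have hρ0 := hP.ρ_pos hρ
  have h1 : ρ * ‖-P.quad (x (k + 1)) + z (k + 1)‖ ≤ Lφ * ‖z (k + 1) - z k‖ := by
    have h2 := hP.isSmooth_φ (z (k + 1)) (z k)
    rw [hA.gradient_eq hP hx k, ← neg_eq_iff_eq_neg.2 (hA.dual_eq hP hx hw k), neg_sub_neg,
      sub_add_cancel_left, norm_neg, norm_smul, Real.norm_of_nonneg hρ0.le] at h2
    exact h2
  have h3 := pow_le_pow_left₀ (by positivity) h1 2
  rw [div_le_iff₀ hP.μφ_pos] at hρ
  have h4 : 4 * Lφ ^ 2 * ‖z (k + 1) - z k‖ ^ 2 ≤ ρ * μφ * ‖z (k + 1) - z k‖ ^ 2 :=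
    mul_le_mul_of_nonneg_right hρ (by positivity)
  refine le_of_mul_le_mul_left ?_ hρ0
  nlinarith

/-- The z step gains (μ_φ/2)‖Δz‖², and the dual step gives back at most half of it. -/
theorem IsADMM.smoothLag_succ_add_le (hA : IsADMM P ρ x z w) (hP : P.IsRegular μf Lf μφ Lφ)
    (hρ : 4 * Lφ ^ 2 / μφ ≤ ρ) (hx : x 0 ∈ P.admissible) (hw : w 0 = -gradient P.φ (z 0))
    (k : ℕ) :
    P.smoothLag ρ (x (k + 1)) (z (k + 1)) (w (k + 1)) + min (μf / 2) (μφ / 4) *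
      (‖x (k + 1) - x k‖ ^ 2 + ‖z (k + 1) - z k‖ ^ 2) ≤ P.smoothLag ρ (x k) (z k) (w k) := by
  have hρ0 := (hP.ρ_pos hρ).le
  have h1 := smoothLag_add_le_of_x_step hP.differentiable_f hP.strongConvex_f hρ0 hP.convex
    (hA.mem_admissible hx k) (hA.mem_admissible hx (k + 1)) (hA.x_step k)
  have h2 := augLag_add_le_of_gradient_eq (f := P.f) (z := z k) hP.differentiable_φ
    hP.strongConvex_φ hρ0 (hA.gradient_eq hP hx k)
  have h3 := augLag_dual_step (f := P.f) (φ := P.φ) (q := P.quad) (ρ := ρ) (x (k + 1))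
    (z (k + 1)) (w k)
  have h4 := hA.sq_residual_le hP hρ hx hw k
  have h5 : min (μf / 2) (μφ / 4) * ‖x (k + 1) - x k‖ ^ 2 ≤ μf / 2 * ‖x (k + 1) - x k‖ ^ 2 :=
    mul_le_mul_of_nonneg_right (min_le_left _ _) (by positivity)
  have h6 : min (μf / 2) (μφ / 4) * ‖z (k + 1) - z k‖ ^ 2 ≤ μφ / 4 * ‖z (k + 1) - z k‖ ^ 2 :=
    mul_le_mul_of_nonneg_right (min_le_right _ _) (by positivity)
  rw [← hA.dual_step k] at h3
  rw [norm_sub_rev (z k)] at h2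
  simp only [Problem.smoothLag] at h1 ⊢
  linarith

theorem IsADMM.smoothLag_le_zero (hA : IsADMM P ρ x z w) (hP : P.IsRegular μf Lf μφ Lφ)
    (hρ : 4 * Lφ ^ 2 / μφ ≤ ρ) (hx : x 0 ∈ P.admissible) (hw : w 0 = -gradient P.φ (z 0))
    (k : ℕ) : P.smoothLag ρ (x k) (z k) (w k) ≤ P.smoothLag ρ (x 0) (z 0) (w 0) := by
  induction k with
  | zero => exact le_rfl
  | succ k ih =>
    have h1 := hA.smoothLag_succ_add_le hP hρ hx hw k
    have h2 : 0 ≤ min (μf / 2) (μφ / 4) :=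
      le_min (half_pos hP.μf_pos).le (by linarith [hP.μφ_pos])
    have h3 : 0 ≤ min (μf / 2) (μφ / 4) *
      (‖x (k + 1) - x k‖ ^ 2 + ‖z (k + 1) - z k‖ ^ 2) := by positivity
    linarith

theorem IsADMM.energy_le (hA : IsADMM P ρ x z w) (hP : P.IsRegular μf Lf μφ Lφ)
    (hρ : 4 * Lφ ^ 2 / μφ ≤ ρ) (hx : x 0 ∈ P.admissible) (hw : w 0 = -gradient P.φ (z 0))
    {xf : Forces N T} {zφ : Momenta T} (hxf : IsMinOn P.f Set.univ xf)
    (hzφ : IsMinOn P.φ Set.univ zφ) (k : ℕ) :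
    μf / 2 * ‖x k - xf‖ ^ 2 + 3 * μφ / 8 * ‖z k - zφ‖ ^ 2
      ≤ P.smoothLag ρ (x 0) (z 0) (w 0) - P.f xf - P.φ zφ := by
  have h1 := hA.smoothLag_le_zero hP hρ hx hw k
  have h2 : P.f (x k) + P.φ zφ + 3 * μφ / 8 * ‖z k - zφ‖ ^ 2 ≤ P.smoothLag ρ (x k) (z k) (w k) :=
    le_augLag_of_dual_eq hP.μφ_pos hρ hP.differentiable_φ hP.strongConvex_φ hP.isSmooth_φ hzφ
      (x k) (hA.dual_eq hP hx hw k)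
  have h3 := add_le_of_strongConvexOn_of_isMinOn hP.strongConvex_f hP.differentiable_f hxf (x k)
  linarith

theorem IsADMM.sq_norm_dual_le (hA : IsADMM P ρ x z w) (hP : P.IsRegular μf Lf μφ Lφ)
    (hρ : 4 * Lφ ^ 2 / μφ ≤ ρ) (hx : x 0 ∈ P.admissible) (hw : w 0 = -gradient P.φ (z 0))
    {xf : Forces N T} {zφ : Momenta T} (hxf : IsMinOn P.f Set.univ xf)
    (hzφ : IsMinOn P.φ Set.univ zφ) (k : ℕ) :
    ‖w k‖ ^ 2 ≤ 8 * Lφ ^ 2 / (3 * μφ) * (P.smoothLag ρ (x 0) (z 0) (w 0) - P.f xf - P.φ zφ) := by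
  have h1 := hA.energy_le hP hρ hx hw hxf hzφ k
  have h2 := hP.isSmooth_φ.norm_gradient_le hzφ (z k)
  rw [← norm_neg, ← hA.dual_eq hP hx hw k] at h2
  have hμφ := hP.μφ_pos
  have hμf := hP.μf_pos
  have h3 : 0 ≤ μf / 2 * ‖x k - xf‖ ^ 2 := by positivity
  calc ‖w k‖ ^ 2 ≤ (Lφ * ‖z k - zφ‖) ^ 2 := pow_le_pow_left₀ (norm_nonneg _) h2 2
    _ = 8 * Lφ ^ 2 / (3 * μφ) * (3 * μφ / 8 * ‖z k - zφ‖ ^ 2) := by field_simp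
    _ ≤ _ := mul_le_mul_of_nonneg_left (by linarith) (by positivity)

theorem IsADMM.exists_norm_le (hA : IsADMM P ρ x z w) (hP : P.IsRegular μf Lf μφ Lφ)
    (hρ : 4 * Lφ ^ 2 / μφ ≤ ρ) (hx : x 0 ∈ P.admissible) (hw : w 0 = -gradient P.φ (z 0))
    {xf : Forces N T} {zφ : Momenta T} (hxf : IsMinOn P.f Set.univ xf)
    (hzφ : IsMinOn P.φ Set.univ zφ) : ∃ r, ∀ k, ‖x k‖ ≤ r := by
  set S := P.smoothLag ρ (x 0) (z 0) (w 0) - P.f xf - P.φ zφ with hS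
  refine ⟨Real.sqrt (2 / μf * S) + ‖xf‖, fun k => ?_⟩
  have h1 := hA.energy_le hP hρ hx hw hxf hzφ k
  have hμφ := hP.μφ_pos
  have hμf := hP.μf_pos
  have h2 : 0 ≤ 3 * μφ / 8 * ‖z k - zφ‖ ^ 2 := by positivity
  have h3 : ‖x k - xf‖ ≤ Real.sqrt (2 / μf * S) := by
    refine Real.le_sqrt_of_sq_le ?_
    calc ‖x k - xf‖ ^ 2 = 2 / μf * (μf / 2 * ‖x k - xf‖ ^ 2) := by field_simp
      _ ≤ 2 / μf * S := mul_le_mul_of_nonneg_left (by linarith) (by positivity)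
  have h4 := norm_le_norm_sub_add (x k) xf
  linarith

/-- The iterates nearly minimize the augmented Lagrangian over the admissible points. -/
theorem IsADMM.exists_gap_bound (hA : IsADMM P ρ x z w) (hP : P.IsRegular μf Lf μφ Lφ)
    (hρ : 4 * Lφ ^ 2 / μφ ≤ ρ) (hx : x 0 ∈ P.admissible) (hw : w 0 = -gradient P.φ (z 0))
    {r W : ℝ} (hr : ∀ k, ‖x k‖ ≤ r) (hW : ∀ k, ‖w k‖ ≤ W)
    (hwB : ∀ k h, ‖w k‖ * ‖P.momBil h h‖ ≤ μf / 4 * ‖h‖ ^ 2) :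
    ∃ C, 0 ≤ C ∧ ∀ k, ∀ y ∈ P.admissible, ∀ ζ,
      P.smoothLag ρ (x (k + 1)) (z (k + 1)) (w (k + 1)) ≤ P.smoothLag ρ y ζ (w (k + 1))
        + C * (‖x (k + 1) - x k‖ ^ 2 + ‖z (k + 1) - z k‖ ^ 2) := by
  have hρ0 := (hP.ρ_pos hρ).le
  have hμφ := hP.μφ_pos
  have hμf := hP.μf_pos
  set κ : ℝ := (T + 1) * (Lf + 2 * ‖P.momBil‖ * W
    + ρ * (1 + (‖P.momLin‖ + 2 * ‖P.momBil‖ * (3 * r)))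
      * (‖P.momLin‖ + 2 * ‖P.momBil‖ * (3 * r))) with hκ
  -- The first term pays for the penalty of the residual, the second for the stationarity error κ√D.
  refine ⟨μφ / 8 + κ ^ 2 / μf, by positivity, fun k y hy ζ => ?_⟩
  set D := ‖x (k + 1) - x k‖ ^ 2 + ‖z (k + 1) - z k‖ ^ 2 with hD
  have hD0 : 0 ≤ D := by positivity
  have hδx : ‖x (k + 1) - x k‖ ≤ Real.sqrt D :=
    Real.le_sqrt_of_sq_le (le_add_of_nonneg_right (by positivity))
  have hδz : ‖z (k + 1) - z k‖ ≤ Real.sqrt D :=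
    Real.le_sqrt_of_sq_le (le_add_of_nonneg_left (by positivity))
  have hW' := hW (k + 1)
  rw [hA.dual_step k] at hW'
  have h1 := stationary_of_x_step hP.differentiable_f hP.isSmooth_f hP.Lf_pos.le hρ0 hP.convex
    (hA.mem_admissible hx k) (hA.mem_admissible hx (k + 1)) (hA.x_step k) (hr k) (hr (k + 1))
    hδx hδz hW' hy
  rw [← hκ, ← hA.dual_step k] at h1
  have h2 := augLag_le_add_of_stationary hμf hμφ.le hP.differentiable_f hP.strongConvex_f
    hP.differentiable_φ hP.strongConvex_φ hρ0 (b := consMomenta P.phys.kInit 0)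
    (hA.dual_eq hP hx hw (k + 1)) (hwB (k + 1)) h1 ζ
  have h3 := hA.sq_residual_le hP hρ hx hw k
  have h4 : (κ * Real.sqrt D) ^ 2 / μf = κ ^ 2 / μf * D := by
    rw [mul_pow, Real.sq_sqrt hD0]
    ring
  have h5 : μφ / 8 * ‖z (k + 1) - z k‖ ^ 2 ≤ μφ / 8 * D :=
    mul_le_mul_of_nonneg_left (le_add_of_nonneg_left (by positivity)) (by positivity)
  change P.smoothLag ρ (x (k + 1)) (z (k + 1)) (w (k + 1)) ≤ P.smoothLag ρ y ζ (w (k + 1))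
    + (ρ / 2 * ‖-P.quad (x (k + 1)) + z (k + 1)‖ ^ 2 + (κ * Real.sqrt D) ^ 2 / μf) at h2
  linarith

/-- The constraint determines z from x, so feasible points are graph points of the quadratic map. -/
theorem Problem.isLocalMinimum_of_forall_le {xs : Forces N T} {zs : Momenta T}
    (hxs : xs ∈ P.admissible) (hzs : zs = P.quad xs)
    (hmin : ∀ y ∈ P.admissible, P.f xs + P.φ zs ≤ P.f y + P.φ (P.quad y)) :
    P.IsLocalMinimum xs zs := by
  refine ⟨?_, hxs, ?_⟩
  · change P.residual xs zs = 0
    rw [P.residual_eq, hzs, neg_add_cancel]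
  · refine eventually_of_mem self_mem_nhdsWithin fun p hp => ?_
    have hp' : P.residual p.1 p.2 = 0 := hp
    rw [P.residual_eq, neg_add_eq_zero] at hp'
    by_cases h : p.1 ∈ P.admissible
    · simp only [P.objective_of_mem hxs, P.objective_of_mem h, ← hp']
      exact EReal.coe_le_coe_iff.2 (hmin _ h)
    · simp only [P.objective_of_notMem h]
      exact le_top

/-- Linear convergence of the ADMM, under a bound on the dual iterates that makes the nonconvexity
of the constraint harmless. -/
theorem IsADMM.linear_convergence (hA : IsADMM P ρ x z w) (hP : P.IsRegular μf Lf μφ Lφ)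
    (hρ : 4 * Lφ ^ 2 / μφ ≤ ρ) (hx : x 0 ∈ P.admissible) (hw : w 0 = -gradient P.φ (z 0))
    {xf : Forces N T} {zφ : Momenta T} (hxf : IsMinOn P.f Set.univ xf)
    (hzφ : IsMinOn P.φ Set.univ zφ)
    (hwB : ∀ k h, ‖w k‖ * ‖P.momBil h h‖ ≤ μf / 4 * ‖h‖ ^ 2) :
    (∃ (c r : ℝ) (l m : ℕ → ℝ), 1 < c ∧ 0 < r ∧
      (∀ k, P.lagrangian ρ (x k) (z k) (w k) = (l k : EReal)) ∧
      (∀ k, IsLeast ((fun p => P.lagrangian ρ p.1 p.2 (w k)) ''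
        Locomotion.ball (x k) (z k) r) (m k : EReal)) ∧
      (fun k => l k - m k) =O[atTop] (fun k : ℕ => c ^ (-(k : ℤ)))) ∧
    (∃ (xs : Forces N T) (zs ws : Momenta T),
      Tendsto x atTop (𝓝 xs) ∧ Tendsto z atTop (𝓝 zs) ∧ Tendsto w atTop (𝓝 ws) ∧
      P.IsLocalMinimum xs zs) := by
  have hadm := hA.mem_admissible hx
  have hfc := hP.differentiable_f.continuous
  have hφc := hP.differentiable_φ.continuous
  obtain ⟨r, hr⟩ := hA.exists_norm_le hP hρ hx hw hxf hzφ
  have hW : ∀ k, ‖w k‖ ≤ Real.sqrt _ := fun k =>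
    Real.le_sqrt_of_sq_le (hA.sq_norm_dual_le hP hρ hx hw hxf hzφ k)
  obtain ⟨C, hC, hgap⟩ := hA.exists_gap_bound hP hρ hx hw hr hW hwB
  have hlow : ∀ k, P.f xf + P.φ zφ ≤ P.smoothLag ρ (x k) (z k) (w k) := fun k => by
    have h1 := le_augLag_of_dual_eq (f := P.f) (q := P.quad) hP.μφ_pos hρ hP.differentiable_φ
      hP.strongConvex_φ hP.isSmooth_φ hzφ (x k) (hA.dual_eq hP hx hw k)
    have h2 := isMinOn_univ_iff.1 hxf (x k)
    have hμφ := hP.μφ_pos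
    have h3 : 0 ≤ 3 * μφ / 8 * ‖z k - zφ‖ ^ 2 := by positivity
    simp only [Problem.smoothLag]
    linarith
  obtain ⟨θ, K, hθ, hθ1, hK, hD, xs, zs, ws, hxs, hzs, hws, hmem, hq, hmin⟩ :=
    exists_linear_convergence hfc hφc P.continuous_quad hP.isSmooth_φ (hP.ρ_pos hρ)
      (lt_min (half_pos hP.μf_pos) (div_pos hP.μφ_pos four_pos)) hC
      (P.isClosed_admissible hP.isClosed) hadm (hA.dual_eq hP hx hw) hA.dual_step hW hlow
      (hA.smoothLag_succ_add_le hP hρ hx hw) hgap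
  refine ⟨?_, xs, zs, ws, hxs, hzs, hws, P.isLocalMinimum_of_forall_le hmem hq hmin⟩
  -- Any positive radius would do, since the gap bound holds over all admissible points; take 1.
  choose p hp hpball hleast using fun k =>
    P.exists_isLeast_ball hP.isClosed hfc hφc (hadm k) (z k) (w k) ρ 1
  refine ⟨θ⁻¹, 1, fun k => P.smoothLag ρ (x k) (z k) (w k),
    fun k => P.smoothLag ρ (p k).1 (p k).2 (w k), (one_lt_inv₀ hθ).2 hθ1, one_pos,
    fun k => P.lagrangian_of_mem (hadm k) ρ _ _, hleast, ?_⟩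
  -- The gap at index k + 1 is controlled by the increment of index k, hence the restriction to
  -- positive indices and the division by θ.
  refine IsBigO.of_bound (C * K / θ) (eventually_atTop.2 ⟨1, fun k hk => ?_⟩)
  obtain ⟨k, rfl⟩ := Nat.exists_eq_add_of_le' hk
  have h1 := hgap k _ (hp (k + 1)) (p (k + 1)).2
  have h2 : P.smoothLag ρ (p (k + 1)).1 (p (k + 1)).2 (w (k + 1))
      ≤ P.smoothLag ρ (x (k + 1)) (z (k + 1)) (w (k + 1)) := by
    rw [← EReal.coe_le_coe_iff, ← P.lagrangian_of_mem (hadm (k + 1))]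
    exact (hleast (k + 1)).2 ⟨(x (k + 1), z (k + 1)), by simp [ball], rfl⟩
  have h3 := mul_le_mul_of_nonneg_left (hD k) hC
  rw [Real.norm_of_nonneg (sub_nonneg.2 h2), inv_zpow', neg_neg, zpow_natCast,
    Real.norm_of_nonneg (by positivity), pow_succ]
  have h4 : C * K / θ * (θ ^ k * θ) = C * (K * θ ^ k) := by field_simp
  rw [h4]
  linarith

end Iterates

/-! ### Uniformity in the time discretization. -/

theorem Problem.sq_norm_quad_le (P : Problem N T) {τ A m : ℝ} (hm : 0 < P.phys.mass)
    (hdt : 0 < P.dt) (hdt1 : P.dt ≤ 1) (hτ : (T : ℝ) * P.dt ≤ τ) (hm0 : 0 ≤ m) {x : Forces N T}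
    (hA : ‖P.momLin x‖ ^ 2 ≤ (P.dt * A) ^ 2 * (N * ‖x‖ ^ 2))
    (hx : ‖x‖ ^ 2 ≤ m * (T + 1)) :
    ‖P.quad x‖ ^ 2 ≤ 3 * (‖P.phys.kInit‖ ^ 2 + A ^ 2 * (N * m)
      + (τ / P.phys.mass * N) ^ 2 * (τ + 1) * (m * (τ + 1)) ^ 2) * (T + 1) := by
  have hτ0 : 0 ≤ τ := le_trans (by positivity) hτ
  have hT1 : (1 : ℝ) ≤ T + 1 := by linarith [(Nat.cast_nonneg T : (0 : ℝ) ≤ T)]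
  have hdt2 : P.dt ^ 2 ≤ 1 := pow_le_one₀ hdt.le hdt1
  have h1 : ‖P.quad x‖ ^ 2
      ≤ 3 * (‖P.phys.kInit‖ ^ 2 + ‖P.momLin x‖ ^ 2 + ‖P.momBil x x‖ ^ 2) := by
    have h2 : ‖P.quad x‖ ≤ ‖P.phys.kInit‖ + ‖P.momLin x‖ + ‖P.momBil x x‖ := by
      have h3 : ‖(consMomenta P.phys.kInit 0 : Momenta T)‖ = ‖P.phys.kInit‖ := by
        rw [← sq_eq_sq₀ (norm_nonneg _) (norm_nonneg _), sq_norm_consMomenta]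
        simp
      rw [← h3]
      exact norm_add₃_le
    have h4 := pow_le_pow_left₀ (norm_nonneg _) h2 2
    nlinarith [sq_nonneg (‖P.phys.kInit‖ - ‖P.momLin x‖),
      sq_nonneg (‖P.phys.kInit‖ - ‖P.momBil x x‖), sq_nonneg (‖P.momLin x‖ - ‖P.momBil x x‖)]
  have h2 : ‖P.momLin x‖ ^ 2 ≤ A ^ 2 * (N * m) * (T + 1) := by
    calc ‖P.momLin x‖ ^ 2 ≤ (P.dt * A) ^ 2 * (N * ‖x‖ ^ 2) := hA
      _ = P.dt ^ 2 * (A ^ 2 * (N * ‖x‖ ^ 2)) := by ring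
      _ ≤ 1 * (A ^ 2 * (N * (m * (T + 1)))) := by gcongr
      _ = _ := by ring
  have h3 : ‖P.momBil x x‖ ^ 2
      ≤ (τ / P.phys.mass * N) ^ 2 * (τ + 1) * (m * (τ + 1)) ^ 2 * (T + 1) := by
    -- Here ‖x‖² grows like T + 1, and one factor Δt compensates for it.
    have h4 : P.dt * ‖x‖ ^ 2 ≤ m * (τ + 1) := by
      calc P.dt * ‖x‖ ^ 2 ≤ P.dt * (m * (T + 1)) := mul_le_mul_of_nonneg_left hx hdt.le
        _ = m * (T * P.dt + P.dt) := by ring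
        _ ≤ m * (τ + 1) := mul_le_mul_of_nonneg_left (add_le_add hτ hdt1) hm0
    calc ‖P.momBil x x‖ ^ 2
        ≤ (τ / P.phys.mass * N) ^ 2 * (τ + 1) * P.dt ^ 3 * (‖x‖ ^ 2 * ‖x‖ ^ 2) :=
          P.sq_norm_momBil_le hm hdt hdt1 hτ x x
      _ = (τ / P.phys.mass * N) ^ 2 * (τ + 1) * (P.dt * ‖x‖ ^ 2) ^ 2 * P.dt := by ring
      _ ≤ (τ / P.phys.mass * N) ^ 2 * (τ + 1) * (m * (τ + 1)) ^ 2 * (T + 1) := by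
          have h5 := hdt1.trans hT1
          gcongr
  have h5 : ‖P.phys.kInit‖ ^ 2 * 1 ≤ ‖P.phys.kInit‖ ^ 2 * (T + 1) :=
    mul_le_mul_of_nonneg_left hT1 (by positivity)
  linarith

theorem sq_norm_sub_le {E : Type*} [SeminormedAddCommGroup E] (u v : E) :
    ‖u - v‖ ^ 2 ≤ 2 * ‖u‖ ^ 2 + 2 * ‖v‖ ^ 2 := by
  have h1 := pow_le_pow_left₀ (norm_nonneg _) (norm_sub_le u v) 2
  nlinarith [sq_nonneg (‖u‖ - ‖v‖)]

/-- The arithmetic behind the choice of the time step. -/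
theorem mul_le_of_sq_le {a b h c S n q δ τ μ : ℝ} (ha : 0 ≤ a) (hb : 0 ≤ b)
    (hc : 0 ≤ c) (hS : 0 ≤ S) (hτ : 0 ≤ τ) (hq : 0 ≤ q) (hμ : 0 ≤ μ) (hδ : 0 ≤ δ) (hδ1 : δ ≤ 1)
    (haS : a ^ 2 ≤ c * (S * n)) (hbq : b ^ 2 ≤ q * δ ^ 3 * (h ^ 2 * h ^ 2)) (hn : n * δ ≤ τ)
    (hsmall : c * S * q * τ * δ ≤ μ ^ 2 / 16) : a * b ≤ μ / 4 * h ^ 2 := by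
  refine (pow_le_pow_iff_left₀ (by positivity) (by positivity) two_ne_zero).1 ?_
  have hδ2 : δ ^ 2 ≤ δ := by nlinarith
  calc (a * b) ^ 2 = a ^ 2 * b ^ 2 := mul_pow _ _ _
    _ ≤ c * (S * n) * (q * δ ^ 3 * (h ^ 2 * h ^ 2)) :=
        mul_le_mul haS hbq (by positivity) ((sq_nonneg a).trans haS)
    -- One of the three factors δ cancels the growth of the dual variable with the number n of
    -- steps; the others supply the smallness.
    _ = c * S * q * h ^ 4 * δ ^ 2 * (n * δ) := by ring
    _ ≤ c * S * q * h ^ 4 * δ ^ 2 * τ := mul_le_mul_of_nonneg_left hn (by positivity)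
    _ = c * S * q * h ^ 4 * τ * δ ^ 2 := by ring
    _ ≤ c * S * q * h ^ 4 * τ * δ := by
        gcongr
    _ = c * S * q * τ * δ * h ^ 4 := by ring
    _ ≤ μ ^ 2 / 16 * h ^ 4 := mul_le_mul_of_nonneg_right hsmall (by positivity)
    _ = (μ / 4 * h ^ 2) ^ 2 := by ring

/-- The excess energy of the initial point is at most proportional to the number of time steps,
with a constant that does not depend on the time discretization. -/
theorem Problem.initial_energy_le (P : Problem N T) {μf Lf μφ Lφ τ A m : ℝ}
    (hP : P.IsRegular μf Lf μφ Lφ) (hm : 0 < P.phys.mass)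
    (hdt : 0 < P.dt) (hdt1 : P.dt ≤ 1) (hτ : (T : ℝ) * P.dt ≤ τ) (hm0 : 0 ≤ m)
    {x xf : Forces N T} {zφ : Momenta T} (hxf : IsMinOn P.f Set.univ xf)
    (hzφ : IsMinOn P.φ Set.univ zφ)
    (hA : ‖P.momLin x‖ ^ 2 ≤ (P.dt * A) ^ 2 * (N * ‖x‖ ^ 2))
    (hx : ‖x‖ ^ 2 ≤ m * (T + 1)) (hxfm : ‖xf‖ ^ 2 ≤ m * (T + 1))
    (hzφm : ‖zφ‖ ^ 2 ≤ m * (T + 1)) :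
    P.f x + P.φ (P.quad x) - P.f xf - P.φ zφ ≤
      (4 * Lf * m + Lφ * (6 * (‖P.phys.kInit‖ ^ 2 + A ^ 2 * (N * m)
        + (τ / P.phys.mass * N) ^ 2 * (τ + 1) * (m * (τ + 1)) ^ 2) + 2 * m)) * (T + 1) := by
  have h1 := sub_le_of_isSmooth_of_isMinOn hP.μf_pos.le hP.strongConvex_f hP.differentiable_f
    hP.isSmooth_f hxf x
  have h2 := sub_le_of_isSmooth_of_isMinOn hP.μφ_pos.le hP.strongConvex_φ hP.differentiable_φ
    hP.isSmooth_φ hzφ (P.quad x)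
  have h3 : Lf * ‖x - xf‖ ^ 2 ≤ Lf * (4 * m * (T + 1)) :=
    mul_le_mul_of_nonneg_left (by linarith [sq_norm_sub_le x xf]) hP.Lf_pos.le
  have h4 := P.sq_norm_quad_le hm hdt hdt1 hτ hm0 hA hx
  have h5 : Lφ * ‖P.quad x - zφ‖ ^ 2 ≤ Lφ * ((6 * (‖P.phys.kInit‖ ^ 2 + A ^ 2 * (N * m)
        + (τ / P.phys.mass * N) ^ 2 * (τ + 1) * (m * (τ + 1)) ^ 2) + 2 * m) * (T + 1)) :=
    mul_le_mul_of_nonneg_left (by linarith [sq_norm_sub_le (P.quad x) zφ]) hP.Lφ_pos.le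
  linarith

end Locomotion

end

theorem mainTheorem9
    (N : ℕ) (phys : Locomotion.Physics) (hmass : 0 < phys.mass)
    (Ttotal R M μf Lf μφ Lφ : ℝ) (hTtotal : 0 < Ttotal)
    (hμf : 0 < μf) (hLf : 0 < Lf) (hμφ : 0 < μφ) (hLφ : 0 < Lφ) :
    ∃ t₀ : ℝ, 0 < t₀ ∧
      ∀ (T : ℕ) (P : Locomotion.Problem N T),
        P.phys = phys → 0 < P.dt → P.dt ≤ t₀ → (T : ℝ) * P.dt ≤ Ttotal →
        (∀ i j, ‖P.contact i j‖ ≤ R) →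
        (∀ i, Locomotion.IsPolyhedral (P.X i)) →
        ContDiff ℝ 2 P.f → StrongConvexOn Set.univ μf P.f → Locomotion.IsSmooth Lf P.f →
        ContDiff ℝ 2 P.φ → StrongConvexOn Set.univ μφ P.φ → Locomotion.IsSmooth Lφ P.φ →
      ∀ (xf : Locomotion.Forces N T) (zφ : Locomotion.Momenta T),
        IsMinOn P.f Set.univ xf → IsMinOn P.φ Set.univ zφ →
        ‖xf‖ ^ 2 ≤ M * (3 * N * (T + 1)) → ‖zφ‖ ^ 2 ≤ M * (3 * (T + 1)) →
      ∀ (ρ : ℝ) (x : ℕ → Locomotion.Forces N T) (z w : ℕ → Locomotion.Momenta T),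
        4 * Lφ ^ 2 / μφ ≤ ρ →
        Locomotion.IsADMM P ρ x z w →
        ‖x 0‖ ^ 2 ≤ M * (3 * N * (T + 1)) →
        (∀ i, x 0 i ∈ P.X i) →
        P.residual (x 0) (z 0) = 0 →
        w 0 = - gradient P.φ (z 0) →
        (∃ (c r : ℝ) (l m : ℕ → ℝ), 1 < c ∧ 0 < r ∧
          (∀ k, P.lagrangian ρ (x k) (z k) (w k) = (l k : EReal)) ∧
          (∀ k, IsLeast ((fun p => P.lagrangian ρ p.1 p.2 (w k)) ''
            Locomotion.ball (x k) (z k) r) (m k : EReal)) ∧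
          (fun k => l k - m k) =O[atTop] (fun k : ℕ => c ^ (-(k : ℤ)))) ∧
        (∃ (xs : Locomotion.Forces N T) (zs ws : Locomotion.Momenta T),
          Tendsto x atTop (𝓝 xs) ∧ Tendsto z atTop (𝓝 zs) ∧ Tendsto w atTop (𝓝 ws) ∧
          P.IsLocalMinimum xs zs) := by
  set τ := Ttotal with hτ_def
  -- `A` bounds the lever arms at zero forces, `m` the squared norms per time step of both forces
  -- and momenta, `S` the excess energy per time step, and `G` Δt is the resulting bound on the
  -- squared curvature ratio.
  set A : ℝ := |R| + (‖phys.cInit‖ + τ * ‖phys.vInit‖ + (τ + 1) * τ * ‖phys.gravity‖) with hA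
  set m : ℝ := |M| * 3 * (N + 1) with hm
  have hm0 : 0 ≤ m := by positivity
  set q : ℝ := (τ / phys.mass * N) ^ 2 * (τ + 1) with hq
  have hq0 : 0 ≤ q := by positivity
  set S : ℝ := 4 * Lf * m + Lφ * (6 * (‖phys.kInit‖ ^ 2 + A ^ 2 * (N * m)
        + q * (m * (τ + 1)) ^ 2) + 2 * m) with hS
  have hS0 : 0 ≤ S := by positivity
  set G : ℝ := 8 * Lφ ^ 2 / (3 * μφ) * S * q * (τ + 1) with hG
  have hG0 : 0 ≤ G := by positivity
  -- μ_f²/16 is the square of the admissible curvature μ_f/4; G + 1 avoids dividing by zero.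
  refine ⟨min 1 (μf ^ 2 / 16 / (G + 1)), lt_min one_pos (by positivity), ?_⟩
  intro T P hphys hdt hdt0 hT hR hX hf hcf hsf hφ hcφ hsφ xf zφ hxf hzφ hxfM hzφM ρ x z w hρ hA'
    hx0M hx0 hres hw0
  have hdt1 : P.dt ≤ 1 := hdt0.trans (min_le_left _ _)
  have hdtG : P.dt * (G + 1) ≤ μf ^ 2 / 16 :=
    (le_div_iff₀ (by positivity)).1 (hdt0.trans (min_le_right _ _))
  have hP : P.IsRegular μf Lf μφ Lφ :=
    ⟨hμf, hLf, hμφ, hLφ, fun i => (hX i).isClosed, fun i => (hX i).convex,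
      hf.differentiable two_ne_zero, hcf, hsf, hφ.differentiable two_ne_zero, hcφ, hsφ⟩
  have hmass' : 0 < P.phys.mass := hphys ▸ hmass
  have hM := le_abs_self M
  have hforces : M * (3 * N * (T + 1)) ≤ m * (T + 1) := by
    calc M * (3 * N * (T + 1)) ≤ |M| * (3 * (N + 1) * (T + 1)) := by
          gcongr
          linarith
      _ = m * (T + 1) := by rw [hm]; ring
  have hmomenta : M * (3 * (T + 1)) ≤ m * (T + 1) := by
    have h1 : 0 ≤ |M| * 3 * N * (T + 1) := by positivity
    calc M * (3 * (T + 1)) ≤ |M| * (3 * (T + 1)) := by gcongr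
      _ ≤ |M| * (3 * (T + 1)) + |M| * 3 * N * (T + 1) := le_add_of_nonneg_right h1
      _ = m * (T + 1) := by rw [hm]; ring
  have hlin := P.sq_norm_momLin_le hdt (fun i j => (hR i j).trans (le_abs_self R))
    (fun i hi => P.norm_comPos_zero_le hdt hdt1 hT hi) (x 0)
  have hS' := P.initial_energy_le hP hmass' hdt hdt1 hT hm0 hxf hzφ hlin (hx0M.trans hforces)
    (hxfM.trans hforces) (hzφM.trans hmomenta)
  rw [hphys] at hS'
  have hz0 : z 0 = P.quad (x 0) := by
    rw [P.residual_eq, neg_add_eq_zero] at hres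
    exact hres.symm
  have hdual : ∀ k, ‖w k‖ ^ 2 ≤ 8 * Lφ ^ 2 / (3 * μφ) * (S * (T + 1)) := by
    intro k
    refine (hA'.sq_norm_dual_le hP hρ hx0 hw0 hxf hzφ k).trans
      (mul_le_mul_of_nonneg_left ?_ (by positivity))
    -- At a feasible starting point the multiplier and penalty terms vanish, so the initial energy,
    -- and with it `t₀`, does not depend on ρ.
    rw [Locomotion.Problem.smoothLag, hz0, Locomotion.augLag_of_eq]
    exact hS'
  refine hA'.linear_convergence hP hρ hx0 hw0 hxf hzφ fun k h => ?_
  have hbil := P.sq_norm_momBil_le hmass' hdt hdt1 hT h h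
  rw [hphys] at hbil
  have hT1 : ((T : ℝ) + 1) * P.dt ≤ τ + 1 := by linarith
  exact Locomotion.mul_le_of_sq_le (norm_nonneg _) (norm_nonneg _) (by positivity)
    hS0 (by positivity) hq0 hμf.le hdt.le hdt1 (hdual k) hbil hT1 (by linarith)
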